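/- Let $(M,\varphi,g)$ be an anti-paraKähler manifold, i.e. $M$ is a smooth manifold, $g$ a smooth Riemannian metric on $M$ with Levi-Civita connection $\nabla$, and $\varphi$ a smooth $(1,1)$-tensor field with $\varphi^2=\mathrm{id}$ whose eigenbundles for the eigenvalues $+1$ and $-1$ have the same rank, such that $g(\varphi X,\varphi Y)=g(X,Y)$ for all vector fields $X,Y$ and $\nabla\varphi=0$. Let $\delta\in\mathbb R$ and let $g_{BS}$ be the Berger type deformed Sasaki metric on the tangent bundle $\pi:TM\to M$, given at $u\in TM$ in terms of the horizontal lifts ${}^HX$ (with respect to $\nabla$) and the vertical lifts ${}^VX$ by $$g_{BS}({}^HX,{}^HY)=g(X,Y),\qquad g_{BS}({}^VX,{}^HY)=0,\qquad g_{BS}({}^VX,{}^VY)=g(X,Y)+\delta^2 g(X,\varphi u)\,g(Y,\varphi u).$$ For a smooth map $f$ between Riemannian manifolds, with local components $f^\gamma$, let $\beta(f)$ denote its second fundamental form, $$\beta(f)\Big(\frac{\partial}{\partial x^i},\frac{\partial}{\partial x^j}\Big)^{\gamma}=\frac{\partial^2 f^\gamma}{\partial x^i\partial x^j}-\Gamma^k_{ij}\frac{\partial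 f^\gamma}{\partial x^k}+\bar\Gamma^\gamma_{\alpha\beta}\frac{\partial f^\alpha}{\partial x^i}\frac{\partial f^\beta}{\partial x^j},$$ where $\Gamma^k_{ij}$ and $\bar\Gamma^\gamma_{\alpha\beta}$ are the Christoffel symbols of the Levi-Civita connections of the source and of the target; $f$ is totally geodesic if $\beta(f)=0$, and harmonic if its tension field $\tau(f)$, the trace of $\beta(f)$ with respect to the metric of the source, vanishes. Then $g_{BS}$ is a smooth Riemannian metric on $TM$, and $\pi:(TM,g_{BS})\to(M,g)$ is a Riemannian submersion. It is totally geodesic if and only if $\nabla$ is locally flat, i.e. its curvature tensor vanishes identically. Moreover, $\pi$ is a harmonic map. -/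

import Mathlib

open scoped Manifold ContDiff

set_option maxSynthPendingDepth 3

noncomputable section

namespace BergerSasaki

/-! ### Levi-Civita connection and curvature on an open subset of a vector space -/

section Local

variable {V : Type*} [NormedAddCommGroup V] [NormedSpace ℝ V]

/-- Christoffel symbols of the second kind of a field of bilinear forms `G` on a vector space,
as the bilinear map `Γ_y(a, b) = Γ^k_{ij} a^i b^j ∂_k`, where
`G_y(Γ_y(a, b), c) = (1/2) (∂_a G(b, c) + ∂_b G(a, c) - ∂_c G(a, b))`.
The index is raised with the inverse of `G_y : V → V*`. -/
def christoffel (G : V → V →L[ℝ] V →L[ℝ] ℝ) (y : V) : V →L[ℝ] V →L[ℝ] V :=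
  let D : V →L[ℝ] V →L[ℝ] V →L[ℝ] ℝ := fderiv ℝ G y
  let D' : V →L[ℝ] V →L[ℝ] V →L[ℝ] ℝ :=
    (ContinuousLinearMap.flipₗᵢ ℝ V V ℝ : (V →L[ℝ] V →L[ℝ] ℝ) →L[ℝ] (V →L[ℝ] V →L[ℝ] ℝ)) ∘L D.flip
  let L : V →L[ℝ] V →L[ℝ] V →L[ℝ] ℝ := (1 / 2 : ℝ) • (D + D.flip - D')
  (ContinuousLinearMap.compL ℝ V (V →L[ℝ] ℝ) V (G y).inverse) ∘L L

/-- The defining formula of `christoffel`, written out. -/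
lemma christoffel_apply (G : V → V →L[ℝ] V →L[ℝ] ℝ) (y a b : V) :
    ∃ ℓ : V →L[ℝ] ℝ, christoffel G y a b = (G y).inverse ℓ ∧
      ∀ c, ℓ c = (1 / 2 : ℝ) *
        (fderiv ℝ G y a b c + fderiv ℝ G y b a c - fderiv ℝ G y c a b) :=
  ⟨_, rfl, fun _ => rfl⟩

/-- The curvature `R_y(a, b) c = ∇_a ∇_b c - ∇_b ∇_a c` of the connection with Christoffel symbols
`christoffel G`, for constant (coordinate) fields `a`, `b`, `c`. -/
def curvatureLocal (G : V → V →L[ℝ] V →L[ℝ] ℝ) (y a b c : V) : V :=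
  fderiv ℝ (christoffel G) y a b c - fderiv ℝ (christoffel G) y b a c
    + christoffel G y a (christoffel G y b c) - christoffel G y b (christoffel G y a c)

end Local

/-! ### Tensors on manifolds, read in charts

The tangent space `TangentSpace I p` is the model space `E`, through the preferred chart at `p`.
So a tensor at `p` is computed in the preferred chart at `p`. All manifolds are without boundary. -/

section Manifold

variable {E : Type*} [NormedAddCommGroup E] [NormedSpace ℝ E]
  {H : Type*} [TopologicalSpace H] (I : ModelWithCorners ℝ E H)
  {M : Type*} [TopologicalSpace M] [ChartedSpace H M]
  {E' : Type*} [NormedAddCommGroup E'] [NormedSpace ℝ E']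
  {H' : Type*} [TopologicalSpace H'] (I' : ModelWithCorners ℝ E' H')
  {N : Type*} [TopologicalSpace N] [ChartedSpace H' N]

/-- The components of a field `h` of bilinear forms on the tangent spaces in the preferred chart
at `p`: the pullback of `h` by the inverse of the chart. -/
def metricInChart (h : ∀ q : M, TangentSpace I q →L[ℝ] TangentSpace I q →L[ℝ] ℝ) (p : M) (y : E) :
    E →L[ℝ] E →L[ℝ] ℝ :=
  let hq : E →L[ℝ] E →L[ℝ] ℝ := h ((extChartAt I p).symm y)
  let e : E →L[ℝ] E := mfderiv 𝓘(ℝ, E) I (extChartAt I p).symm y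
  hq.bilinearComp e e

/-- The components of a field `φ` of endomorphisms in the preferred chart at `p`. -/
def endoInChart (φ : ∀ q : M, TangentSpace I q →L[ℝ] TangentSpace I q) (p : M) (y : E) :
    E →L[ℝ] E :=
  (mfderiv I 𝓘(ℝ, E) (extChartAt I p) ((extChartAt I p).symm y)) ∘L
    (φ ((extChartAt I p).symm y)) ∘L (mfderiv 𝓘(ℝ, E) I (extChartAt I p).symm y)

/-- The Christoffel symbols of `h` at `p` in the preferred chart at `p`. -/
def christoffelAt (h : ∀ q : M, TangentSpace I q →L[ℝ] TangentSpace I q →L[ℝ] ℝ) (p : M) :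
    TangentSpace I p →L[ℝ] TangentSpace I p →L[ℝ] TangentSpace I p :=
  christoffel (V := E) (metricInChart I h p) (extChartAt I p p)

/-- The curvature tensor `R(a, b) c` at `p` of the Levi-Civita connection of `h`. -/
def curvature (h : ∀ q : M, TangentSpace I q →L[ℝ] TangentSpace I q →L[ℝ] ℝ) (p : M)
    (a b c : TangentSpace I p) : TangentSpace I p :=
  curvatureLocal (V := E) (metricInChart I h p) (extChartAt I p p) a b c

/-- The Levi-Civita connection of `h` is locally flat: its curvature tensor vanishes. -/
def IsLocallyFlat (h : ∀ q : M, TangentSpace I q →L[ℝ] TangentSpace I q →L[ℝ] ℝ) : Prop :=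
  ∀ (p : M) (a b c : TangentSpace I p), curvature I h p a b c = 0

/-- The covariant derivative `(∇_a φ) b` at `p` of a field of endomorphisms, for the Levi-Civita
connection of `h`: in components `a^k b^j (∂_k φ^i_j + Γ^i_{kl} φ^l_j - φ^i_l Γ^l_{kj})`. -/
def covDerivEndo (h : ∀ q : M, TangentSpace I q →L[ℝ] TangentSpace I q →L[ℝ] ℝ)
    (φ : ∀ q : M, TangentSpace I q →L[ℝ] TangentSpace I q) (p : M)
    (a b : TangentSpace I p) : TangentSpace I p :=
  let dφ : E →L[ℝ] E →L[ℝ] E := fderiv ℝ (endoInChart I φ p) (extChartAt I p p)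
  let Γ : E →L[ℝ] E →L[ℝ] E := christoffelAt I h p
  let φp : E →L[ℝ] E := φ p
  (dφ a b + Γ a (φp b) - φp (Γ a b) : E)

/-- The second fundamental form `β(f)_p(a, b)` of a map `f : (M, h) → (N, h')`: in components
`a^i b^j (∂_i ∂_j f^γ - Γ^k_{ij} ∂_k f^γ + Γ'^γ_{αβ} ∂_i f^α ∂_j f^β)`. -/
def secondFundamentalForm (h : ∀ q : M, TangentSpace I q →L[ℝ] TangentSpace I q →L[ℝ] ℝ)
    (h' : ∀ q : N, TangentSpace I' q →L[ℝ] TangentSpace I' q →L[ℝ] ℝ) (f : M → N) (p : M)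
    (a b : TangentSpace I p) : TangentSpace I' (f p) :=
  let F : E → E' := writtenInExtChartAt I I' p f
  let y : E := extChartAt I p p
  let dF : TangentSpace I p →L[ℝ] TangentSpace I' (f p) := fderiv ℝ F y
  let d2F : TangentSpace I p →L[ℝ] TangentSpace I p →L[ℝ] TangentSpace I' (f p) :=
    fderiv ℝ (fderiv ℝ F) y
  d2F a b - dF (christoffelAt I h p a b) + christoffelAt I' h' (f p) (dF a) (dF b)

/-- The tension field `τ(f)_p`, the trace of the second fundamental form:
`h^{ij} β(f)_p(e_i, e_j)` for a basis `e` of the tangent space at `p`. -/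
def tensionField [FiniteDimensional ℝ E]
    (h : ∀ q : M, TangentSpace I q →L[ℝ] TangentSpace I q →L[ℝ] ℝ)
    (h' : ∀ q : N, TangentSpace I' q →L[ℝ] TangentSpace I' q →L[ℝ] ℝ) (f : M → N) (p : M) :
    TangentSpace I' (f p) :=
  let e := Module.finBasis ℝ E
  let G : E →L[ℝ] E →L[ℝ] ℝ := h p
  ∑ i, ∑ j, e.coord i (G.inverse (LinearMap.toContinuousLinearMap (e.coord j))) •
    secondFundamentalForm I I' h h' f p (e i) (e j)

/-- `f : (M, h) → (N, h')` is totally geodesic: its second fundamental form vanishes. -/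
def IsTotallyGeodesic (h : ∀ q : M, TangentSpace I q →L[ℝ] TangentSpace I q →L[ℝ] ℝ)
    (h' : ∀ q : N, TangentSpace I' q →L[ℝ] TangentSpace I' q →L[ℝ] ℝ) (f : M → N) : Prop :=
  ContMDiff I I' ∞ f ∧
    ∀ (p : M) (a b : TangentSpace I p), secondFundamentalForm I I' h h' f p a b = 0

/-- `f : (M, h) → (N, h')` is harmonic: its tension field vanishes. -/
def IsHarmonic [FiniteDimensional ℝ E]
    (h : ∀ q : M, TangentSpace I q →L[ℝ] TangentSpace I q →L[ℝ] ℝ)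
    (h' : ∀ q : N, TangentSpace I' q →L[ℝ] TangentSpace I' q →L[ℝ] ℝ) (f : M → N) : Prop :=
  ContMDiff I I' ∞ f ∧ ∀ p : M, tensionField I I' h h' f p = 0

/-- `f : (M, h) → (N, h')` is a Riemannian submersion: a smooth surjective submersion whose
differential is isometric on the orthogonal complement of its kernel. -/
structure IsRiemannianSubmersion
    (h : ∀ q : M, TangentSpace I q →L[ℝ] TangentSpace I q →L[ℝ] ℝ)
    (h' : ∀ q : N, TangentSpace I' q →L[ℝ] TangentSpace I' q →L[ℝ] ℝ) (f : M → N) : Prop where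
  contMDiff : ContMDiff I I' ∞ f
  surjective : Function.Surjective f
  surjective_mfderiv (p : M) : Function.Surjective (mfderiv I I' f p)
  isometric (p : M) (a b : TangentSpace I p)
    (ha : ∀ c, mfderiv I I' f p c = 0 → h p a c = 0)
    (hb : ∀ c, mfderiv I I' f p c = 0 → h p b c = 0) :
    h' (f p) (mfderiv I I' f p a) (mfderiv I I' f p b) = h p a b

/-! ### Anti-paraKähler manifolds -/

variable [IsManifold I ∞ M]

/-- `φ` is an almost paracomplex structure: a smooth field of endomorphisms with `φ² = id` whose
eigenbundles for `1` and `-1` have the same rank. -/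
structure IsAlmostParacomplex (φ : ∀ q : M, TangentSpace I q →L[ℝ] TangentSpace I q) : Prop where
  contMDiff : ContMDiff I (I.prod 𝓘(ℝ, E →L[ℝ] E)) ∞
    (fun q ↦ Bundle.TotalSpace.mk' (E →L[ℝ] E) (E := fun q : M ↦ TangentSpace I q →L[ℝ] TangentSpace I q)
      q (φ q))
  sq_eq_id (q : M) (a : TangentSpace I q) : φ q (φ q a) = a
  rank_eq (q : M) :
    Module.finrank ℝ (Module.End.eigenspace (φ q : TangentSpace I q →ₗ[ℝ] TangentSpace I q) 1) =
    Module.finrank ℝ (Module.End.eigenspace (φ q : TangentSpace I q →ₗ[ℝ] TangentSpace I q) (-1))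

/-- `(M, φ, g)` is an almost anti-paraHermitian manifold. -/
structure IsAlmostAntiParaHermitian (g : Bundle.ContMDiffRiemannianMetric I ∞ E (TangentSpace I : M → Type _))
    (φ : ∀ q : M, TangentSpace I q →L[ℝ] TangentSpace I q) : Prop
    extends IsAlmostParacomplex I φ where
  metric_comp (q : M) (a b : TangentSpace I q) : g.inner q (φ q a) (φ q b) = g.inner q a b

/-- `(M, φ, g)` is an anti-paraKähler manifold: moreover `∇φ = 0`. -/
structure IsAntiParaKahler (g : Bundle.ContMDiffRiemannianMetric I ∞ E (TangentSpace I : M → Type _))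
    (φ : ∀ q : M, TangentSpace I q →L[ℝ] TangentSpace I q) : Prop
    extends IsAlmostAntiParaHermitian I g φ where
  parallel (q : M) (a b : TangentSpace I q) : covDerivEndo I g.inner φ q a b = 0

/-! ### The tangent bundle

The preferred chart of `TM` at `v` is induced by the preferred chart `(x^i)` of `M` at `π v`; its
coordinates are `(x^i, u^i)`. So `T_v(TM)` is `E × E`, with coordinates `(dx^i, du^i)`, and the
`u`-coordinates of `v` itself are `v.2`. -/

/-- The vertical lift `X^i ∂/∂u^i` of `X` to `v`. -/
def verticalLift (v : TangentBundle I M) (X : TangentSpace I v.proj) : TangentSpace I.tangent v :=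
  ((0, X) : E × E)

/-- The horizontal lift `X^i (∂/∂x^i - Γ^h_{ij} u^j ∂/∂u^h)` of `X` to `v`. -/
def horizontalLift (h : ∀ q : M, TangentSpace I q →L[ℝ] TangentSpace I q →L[ℝ] ℝ)
    (v : TangentBundle I M) (X : TangentSpace I v.proj) : TangentSpace I.tangent v :=
  ((X, -(christoffelAt I h v.proj X v.2 : E)) : E × E)

/-- The connection map `T_v(TM) → T_{π v} M`, with components `δu^i = du^i + Γ^i_{hj} u^j dx^h`. -/
def connectionMap (h : ∀ q : M, TangentSpace I q →L[ℝ] TangentSpace I q →L[ℝ] ℝ)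
    (v : TangentBundle I M) : TangentSpace I.tangent v →L[ℝ] TangentSpace I v.proj :=
  let Γ : E →L[ℝ] E →L[ℝ] E := christoffelAt I h v.proj
  let u : E := v.2
  (ContinuousLinearMap.snd ℝ E E + Γ.flip u ∘L ContinuousLinearMap.fst ℝ E E : E × E →L[ℝ] E)

/-- The Berger type deformed Sasaki metric: horizontal and vertical vectors are orthogonal, it is
`g` on horizontal lifts and `g(X, Y) + δ² g(X, φ u) g(Y, φ u)` on vertical lifts at `u`
(see `bergerSasaki_horizontal`, `bergerSasaki_mixed`, `bergerSasaki_vertical`). -/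
def bergerSasaki (g : Bundle.ContMDiffRiemannianMetric I ∞ E (TangentSpace I : M → Type _))
    (φ : ∀ q : M, TangentSpace I q →L[ℝ] TangentSpace I q) (δ : ℝ) (v : TangentBundle I M) :
    TangentSpace I.tangent v →L[ℝ] TangentSpace I.tangent v →L[ℝ] ℝ :=
  let gq : E →L[ℝ] E →L[ℝ] ℝ := g.inner v.proj
  let dπ : E × E →L[ℝ] E := mfderiv I.tangent I (Bundle.TotalSpace.proj : TangentBundle I M → M) v
  let K : E × E →L[ℝ] E := connectionMap I g.inner v
  let θ : E × E →L[ℝ] ℝ := gq (φ v.proj v.2) ∘L K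
  (gq.bilinearComp dπ dπ + gq.bilinearComp K K + δ ^ 2 • θ.smulRight θ :
    E × E →L[ℝ] E × E →L[ℝ] ℝ)

lemma mfderiv_proj_apply (v : TangentBundle I M) (A : TangentSpace I.tangent v) :
    mfderiv I.tangent I (Bundle.TotalSpace.proj : TangentBundle I M → M) v A = (A : E × E).1 := by
  have hd : MDifferentiableAt I.tangent I (Bundle.TotalSpace.proj : TangentBundle I M → M) v :=
    (Bundle.contMDiff_proj (n := 1) (IB := I) (TangentSpace I : M → Type _)).mdifferentiableAt
      one_ne_zero
  have hw : writtenInExtChartAt I.tangent I v (Bundle.TotalSpace.proj : TangentBundle I M → M)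
      =ᶠ[nhdsWithin (extChartAt I.tangent v v) (Set.range I.tangent)]
        (Prod.fst : E × E → E) := by
    filter_upwards [extChartAt_target_mem_nhdsWithin (I := I.tangent) v] with y hy
    have h1 : y.1 ∈ (extChartAt I v.proj).target := by
      have := hy
      rw [FiberBundle.extChartAt_target] at this
      exact this.1.1
    have h2 : ((extChartAt I.tangent v).symm y).proj = (extChartAt I v.proj).symm y.1 := by
      have hy' : I.tangent.symm y ∈ (chartAt (ModelProd H E) v).target := by
        rw [extChartAt_target] at hy
        exact hy.1
      exact FiberBundle.chartedSpace_chartAt_symm_fst (HB := H) v _ hy'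
    show extChartAt I v.proj ((extChartAt I.tangent v).symm y).proj = y.1
    rw [h2, (extChartAt I v.proj).right_inv h1]
  have hu : UniqueDiffWithinAt ℝ (Set.range I.tangent) (extChartAt I.tangent v v) :=
    I.tangent.uniqueDiffOn.uniqueDiffWithinAt (Set.mem_range_self _)
  have he : (mfderiv I.tangent I (Bundle.TotalSpace.proj : TangentBundle I M → M) v :
      E × E →L[ℝ] E) = ContinuousLinearMap.fst ℝ E E :=
    hd.mfderiv.trans ((hw.fderivWithin_eq_of_mem (extChartAt_target_subset_range v
      (mem_extChartAt_target v))).trans (fderivWithin_fst hu))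
  exact congrArg (fun L : E × E →L[ℝ] E => L A) he

lemma bergerSasaki_apply (g : Bundle.ContMDiffRiemannianMetric I ∞ E (TangentSpace I : M → Type _))
    (φ : ∀ q : M, TangentSpace I q →L[ℝ] TangentSpace I q) (δ : ℝ) (v : TangentBundle I M)
    (A B : TangentSpace I.tangent v) :
    bergerSasaki I g φ δ v A B =
      g.inner v.proj (A : E × E).1 (B : E × E).1 +
        g.inner v.proj (connectionMap I g.inner v A) (connectionMap I g.inner v B) +
        δ ^ 2 * (g.inner v.proj (φ v.proj v.2) (connectionMap I g.inner v A) *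
          g.inner v.proj (φ v.proj v.2) (connectionMap I g.inner v B)) := by
  rw [← mfderiv_proj_apply I v A, ← mfderiv_proj_apply I v B]
  rfl

lemma connectionMap_horizontalLift
    (h : ∀ q : M, TangentSpace I q →L[ℝ] TangentSpace I q →L[ℝ] ℝ)
    (v : TangentBundle I M) (X : TangentSpace I v.proj) :
    connectionMap I h v (horizontalLift I h v X) = 0 :=
  neg_add_cancel (christoffelAt I h v.proj X v.2 : E)

lemma connectionMap_verticalLift
    (h : ∀ q : M, TangentSpace I q →L[ℝ] TangentSpace I q →L[ℝ] ℝ)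
    (v : TangentBundle I M) (X : TangentSpace I v.proj) :
    connectionMap I h v (verticalLift I v X) = X := by
  have h1 : ∀ (Γ : E →L[ℝ] E →L[ℝ] E) (u w : E), w + Γ 0 u = w := fun Γ u w => by simp
  exact h1 (christoffelAt I h v.proj) v.2 X

lemma bergerSasaki_horizontal (g : Bundle.ContMDiffRiemannianMetric I ∞ E (TangentSpace I : M → Type _))
    (φ : ∀ q : M, TangentSpace I q →L[ℝ] TangentSpace I q) (δ : ℝ) (v : TangentBundle I M)
    (X Y : TangentSpace I v.proj) :
    bergerSasaki I g φ δ v (horizontalLift I g.inner v X) (horizontalLift I g.inner v Y) =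
      g.inner v.proj X Y := by
  rw [bergerSasaki_apply, connectionMap_horizontalLift, connectionMap_horizontalLift]
  simp [horizontalLift]

lemma bergerSasaki_mixed (g : Bundle.ContMDiffRiemannianMetric I ∞ E (TangentSpace I : M → Type _))
    (φ : ∀ q : M, TangentSpace I q →L[ℝ] TangentSpace I q) (δ : ℝ) (v : TangentBundle I M)
    (X Y : TangentSpace I v.proj) :
    bergerSasaki I g φ δ v (verticalLift I v X) (horizontalLift I g.inner v Y) = 0 ∧
      bergerSasaki I g φ δ v (horizontalLift I g.inner v X) (verticalLift I v Y) = 0 := by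
  have h0 : ∀ Z : TangentSpace I v.proj, g.inner v.proj Z (0 : E) = 0 := fun Z => map_zero _
  have h0' : ∀ Z : TangentSpace I v.proj, g.inner v.proj (0 : E) Z = 0 := fun Z =>
    (g.symm _ _ _).trans (h0 Z)
  constructor <;> rw [bergerSasaki_apply, connectionMap_horizontalLift,
    connectionMap_verticalLift] <;> simp [horizontalLift, verticalLift, h0, h0']

lemma bergerSasaki_vertical (g : Bundle.ContMDiffRiemannianMetric I ∞ E (TangentSpace I : M → Type _))
    (φ : ∀ q : M, TangentSpace I q →L[ℝ] TangentSpace I q) (δ : ℝ) (v : TangentBundle I M)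
    (X Y : TangentSpace I v.proj) :
    bergerSasaki I g φ δ v (verticalLift I v X) (verticalLift I v Y) =
      g.inner v.proj X Y +
        δ ^ 2 * g.inner v.proj X (φ v.proj v.2) * g.inner v.proj Y (φ v.proj v.2) := by
  have h0 : g.inner v.proj (0 : E) (0 : E) = 0 := map_zero _
  rw [bergerSasaki_apply, connectionMap_verticalLift, connectionMap_verticalLift,
    g.symm _ X (φ v.proj v.2), g.symm _ Y (φ v.proj v.2)]
  simp only [verticalLift, h0]
  ring

end Manifold

end BergerSasaki

end

noncomputable section

namespace BergerSasaki

open Filter Topology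

/-! ### Christoffel symbols of a field of bilinear forms in coordinates. -/

section LocalGeometry

variable {V : Type*} [NormedAddCommGroup V] [NormedSpace ℝ V]

/-! In the coordinates (x, u) of TM induced by a chart, π is the first projection, so β(π)(A, B) is
the Christoffel symbol of g minus the first component of that of g_BS. Pairing this first component
with c under g is the same as pairing the whole symbol with the horizontal lift of c under g_BS, and
Koszul's formula applies. Since ∇ is metric and ∇φ = 0, the fibre metric ⟨k, l⟩ = g(k, l) + δ² g(φu,
k) g(φu, l) is preserved by parallel transport. All terms then cancel except the curvature created
by the non-integrability of the horizontal distribution. With K the connection map, a = dπ A and b =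
dπ B, g(β(A, B), c) = -½ (⟨K B, R(a, c)u⟩ + ⟨K A, R(b, c)u⟩); this is
`IsParallelAt.inner_secondFundamentalFormLocal`.

If R = 0 then β = 0. Conversely, taking for A the vertical lift of R(b, c)u and for B the horizontal
lift of b leaves -½ ⟨R(b, c)u, R(b, c)u⟩, so β = 0 forces R = 0. Moreover β vanishes on pairs of
horizontal and on pairs of vertical vectors, so it is odd under the isometric reflection in the
horizontal space, and its trace is zero (`sum_inverse_mul_eq_zero_of_involution`).

To transfer this to TM, g_BS has to be computed in one fixed chart at nearby points, although its
value at v is defined through the preferred chart at π v. The transformation law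
`fderiv_apply_christoffel` absorbs the second derivatives of the transition maps, which gives
`metricInChart_bergerSasaki` and with it the smoothness of g_BS. For the submersion property, a
vector orthogonal to the vertical space has K = 0, and on such vectors g_BS is g. -/

lemma isInvertible_of_pos [FiniteDimensional ℝ V] {B : V →L[ℝ] V →L[ℝ] ℝ}
    (hB : ∀ v, v ≠ 0 → 0 < B v v) : B.IsInvertible := by
  have hinj : Function.Injective (B : V →ₗ[ℝ] (V →L[ℝ] ℝ)) := by
    rw [injective_iff_map_eq_zero]
    intro v hv
    by_contra h
    have h1 : B v = 0 := hv
    simpa [h1] using hB v h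
  have hdim : Module.finrank ℝ V = Module.finrank ℝ (V →L[ℝ] ℝ) := by
    rw [← (LinearMap.toContinuousLinearMap (𝕜 := ℝ) (E := V) (F' := ℝ)).finrank_eq]
    exact (Subspace.dual_finrank_eq (K := ℝ) (V := V)).symm
  refine ⟨(LinearEquiv.ofInjectiveOfFinrankEq _ hinj hdim).toContinuousLinearEquiv, ?_⟩
  ext v w
  rfl

/-- By compactness the form has a positive minimum on the unit sphere, and homogeneity turns it into
a norm bound. The case of an empty sphere is that of the zero space. -/
lemma isVonNBounded_of_pos [FiniteDimensional ℝ V] {B : V →L[ℝ] V →L[ℝ] ℝ}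
    (hB : ∀ v, v ≠ 0 → 0 < B v v) : Bornology.IsVonNBounded ℝ {v : V | B v v < 1} := by
  have hcont : Continuous fun v : V => B v v := by fun_prop
  rw [NormedSpace.isVonNBounded_iff]
  rcases (Metric.sphere (0 : V) 1).eq_empty_or_nonempty with he | hne
  · have : ∀ v : V, v = 0 := by
      intro v
      by_contra hv
      have : ‖v‖⁻¹ • v ∈ Metric.sphere (0 : V) 1 := by
        simp [norm_smul, hv]
      rw [he] at this
      exact this
    exact (Metric.isBounded_ball (x := (0 : V)) (r := 1)).subset fun v _ => by simp [this v]
  · obtain ⟨x, hx, hmin⟩ := (isCompact_sphere (0 : V) 1).exists_isMinOn hne hcont.continuousOn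
    have hx0 : x ≠ 0 := by
      rintro rfl
      simp at hx
    have hm : 0 < B x x := hB x hx0
    refine (Metric.isBounded_closedBall (x := (0 : V)) (r := 1 + 1 / B x x)).subset ?_
    intro v hv
    simp only [Set.mem_ofPred_eq] at hv
    rw [mem_closedBall_zero_iff]
    by_cases hv0 : v = 0
    · simp only [hv0, norm_zero]
      positivity
    have hn : 0 < ‖v‖ := norm_pos_iff.mpr hv0
    have h1 : B x x ≤ B (‖v‖⁻¹ • v) (‖v‖⁻¹ • v) := hmin (by simp [norm_smul, hv0])
    have h2 : B x x * (‖v‖ * ‖v‖) < 1 := by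
      simp only [map_smul, smul_apply, smul_eq_mul] at h1
      calc B x x * (‖v‖ * ‖v‖) ≤ (‖v‖⁻¹ * (‖v‖⁻¹ * B v v)) * (‖v‖ * ‖v‖) := by gcongr
        _ = B v v := by field_simp
        _ < 1 := hv
    have h3 : ‖v‖ * ‖v‖ < 1 / B x x := by
      rw [lt_div_iff₀ hm]
      linarith
    -- From 2‖v‖ ≤ 1 + ‖v‖²; this is why the radius `1 + 1 / B x x` suffices and no square root is
    -- needed.
    nlinarith [sq_nonneg (‖v‖ - 1)]

lemma inner_inverse_apply {B : V →L[ℝ] V →L[ℝ] ℝ} (hB : B.IsInvertible) (l : V →L[ℝ] ℝ) :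
    B (B.inverse l) = l := by
  obtain ⟨e, rfl⟩ := hB
  simp

lemma inner_christoffel {G : V → V →L[ℝ] V →L[ℝ] ℝ} {y : V} (hG : (G y).IsInvertible) (a b c : V) :
    G y (christoffel G y a b) c = (1 / 2 : ℝ) *
        (fderiv ℝ G y a b c + fderiv ℝ G y b a c - fderiv ℝ G y c a b) := by
  obtain ⟨l, h1, h2⟩ := christoffel_apply G y a b
  rw [h1, inner_inverse_apply hG, h2]

lemma fderiv_apply₂_eq {W X : Type*} [NormedAddCommGroup W] [NormedSpace ℝ W]
    [NormedAddCommGroup X] [NormedSpace ℝ X] {G : X → V →L[ℝ] V →L[ℝ] W} {y : X}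
    (hG : DifferentiableAt ℝ G y) (a : X) (b c : V) :
    fderiv ℝ G y a b c = fderiv ℝ (fun z => G z b c) y a := by
  have := ((hG.hasFDerivAt.clm_apply (hasFDerivAt_const b y)).clm_apply
    (hasFDerivAt_const c y)).fderiv
  rw [this]
  simp

lemma fderiv_symm_of_eventually_symm {G : V → V →L[ℝ] V →L[ℝ] ℝ} {y : V}
    (hd : DifferentiableAt ℝ G y) (hs : ∀ᶠ z in 𝓝 y, ∀ b c, G z b c = G z c b) (a b c : V) :
    fderiv ℝ G y a b c = fderiv ℝ G y a c b := by
  rw [fderiv_apply₂_eq hd, fderiv_apply₂_eq hd]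
  exact congrArg (fun L : V →L[ℝ] ℝ => L a)
    (Filter.EventuallyEq.fderiv_eq (hs.mono fun z hz => hz b c))

lemma inner_eq_imp {B : V →L[ℝ] V →L[ℝ] ℝ} (hB : B.IsInvertible) {v w : V}
    (h : ∀ c, B v c = B w c) : v = w := by
  obtain ⟨e, rfl⟩ := hB
  exact e.injective (ContinuousLinearMap.ext h)

lemma christoffel_symm {G : V → V →L[ℝ] V →L[ℝ] ℝ} {y : V} (hG : (G y).IsInvertible)
    (hd : DifferentiableAt ℝ G y) (hs : ∀ᶠ z in 𝓝 y, ∀ b c, G z b c = G z c b) (a b : V) :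
    christoffel G y a b = christoffel G y b a := by
  refine inner_eq_imp hG fun c => ?_
  rw [inner_christoffel hG, inner_christoffel hG, fderiv_symm_of_eventually_symm hd hs c a b]
  ring

/-- The Levi-Civita connection is metric. -/
lemma fderiv_metric_eq {G : V → V →L[ℝ] V →L[ℝ] ℝ} {y : V} (hG : (G y).IsInvertible)
    (hd : DifferentiableAt ℝ G y) (hs : ∀ᶠ z in 𝓝 y, ∀ b c, G z b c = G z c b) (a b c : V) :
    fderiv ℝ G y a b c = G y (christoffel G y a b) c + G y b (christoffel G y a c) := by
  rw [hs.self_of_nhds b, inner_christoffel hG, inner_christoffel hG,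
    fderiv_symm_of_eventually_symm hd hs b a c, fderiv_symm_of_eventually_symm hd hs c a b,
    fderiv_symm_of_eventually_symm hd hs a c b]
  ring

/-- Inversion of operators is smooth at an invertible one; the other ingredients are linear in the
first derivative of the metric. -/
lemma contDiffAt_christoffel [CompleteSpace V] {G : V → V →L[ℝ] V →L[ℝ] ℝ} {y : V}
    (hG : (G y).IsInvertible) (hs : ContDiffAt ℝ ∞ G y) : ContDiffAt ℝ ∞ (christoffel G) y := by
  have hD : ContDiffAt ℝ ∞ (fderiv ℝ G) y := hs.fderiv_right (m := ∞) (by simp)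
  have hflip : ContDiffAt ℝ ∞ (fun z => (fderiv ℝ G z).flip) y :=
    (ContinuousLinearMap.flipₗᵢ ℝ V V (V →L[ℝ] ℝ)).toContinuousLinearEquiv.contDiff.comp_contDiffAt
      y hD
  have hinv : ContDiffAt ℝ ∞ (fun z => (G z).inverse) y :=
    hG.contDiffAt_map_inverse.comp y hs
  have hcomp : ContDiffAt ℝ ∞
      (fun z => ContinuousLinearMap.compL ℝ V (V →L[ℝ] ℝ) V (G z).inverse) y :=
    (ContinuousLinearMap.compL ℝ V (V →L[ℝ] ℝ) V).contDiff.comp_contDiffAt y hinv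
  exact hcomp.clm_comp (((hD.add hflip).sub (contDiffAt_const.clm_comp hflip)).const_smul (1 / 2 : ℝ))

/-- Transformation law of the Christoffel symbols. -/
lemma fderiv_apply_christoffel {G G' : V → V →L[ℝ] V →L[ℝ] ℝ} {κ : V → V} {y : V}
    (hG : (G y).IsInvertible) (hG' : (G' (κ y)).IsInvertible)
    (hd' : DifferentiableAt ℝ G' (κ y))
    (hs' : ∀ᶠ z in 𝓝 (κ y), ∀ b c, G' z b c = G' z c b)
    (hκ : ContDiffAt ℝ ∞ κ y) (hsurj : Function.Surjective (fderiv ℝ κ y))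
    (hpull : ∀ᶠ z in 𝓝 y, ∀ b c, G z b c = G' (κ z) (fderiv ℝ κ z b) (fderiv ℝ κ z c))
    (hd : DifferentiableAt ℝ G y) (a b : V) :
    fderiv ℝ κ y (christoffel G y a b) =
      fderiv ℝ (fderiv ℝ κ) y a b + christoffel G' (κ y) (fderiv ℝ κ y a) (fderiv ℝ κ y b) := by
  have hDκ : DifferentiableAt ℝ (fderiv ℝ κ) y :=
    (hκ.fderiv_right (m := ∞) (by simp)).differentiableAt (by simp)
  have hsymm : ∀ a b, fderiv ℝ (fderiv ℝ κ) y a b = fderiv ℝ (fderiv ℝ κ) y b a := fun a b =>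
    (hκ.isSymmSndFDerivAt (by simpa using ENat.LEInfty.out)) a b
  have key : ∀ a b c, fderiv ℝ G y a b c =
      fderiv ℝ G' (κ y) (fderiv ℝ κ y a) (fderiv ℝ κ y b) (fderiv ℝ κ y c) +
      G' (κ y) (fderiv ℝ (fderiv ℝ κ) y a b) (fderiv ℝ κ y c) +
      G' (κ y) (fderiv ℝ κ y b) (fderiv ℝ (fderiv ℝ κ) y a c) := by
    intro a b c
    rw [fderiv_apply₂_eq hd]
    have h1 : (fun z => G z b c) =ᶠ[𝓝 y]
        fun z => G' (κ z) (fderiv ℝ κ z b) (fderiv ℝ κ z c) := hpull.mono fun z hz => hz b c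
    rw [h1.fderiv_eq]
    have hκd : HasFDerivAt κ (fderiv ℝ κ y) y := (hκ.differentiableAt (by simp)).hasFDerivAt
    have hb := hDκ.hasFDerivAt.clm_apply (hasFDerivAt_const b y)
    have hc := hDκ.hasFDerivAt.clm_apply (hasFDerivAt_const c y)
    have hG'κ : HasFDerivAt (fun z => G' (κ z)) (fderiv ℝ G' (κ y) ∘L fderiv ℝ κ y) y :=
      hd'.hasFDerivAt.comp y hκd
    rw [((hG'κ.clm_apply hb).clm_apply hc).fderiv]
    simp
    ring
  -- It suffices to pair with vectors in the image of dκ, which is everything. After inserting `key`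
  -- in the three Koszul terms, symmetry of the second derivative of κ cancels all second-order
  -- terms except the one in a and b.
  refine inner_eq_imp hG' fun c' => ?_
  obtain ⟨c, rfl⟩ := hsurj c'
  rw [← hpull.self_of_nhds, inner_christoffel hG, map_add, add_apply,
    inner_christoffel hG', key, key, key, hsymm c a, hsymm c b, hsymm b a,
    hs'.self_of_nhds (fderiv ℝ κ y b), hs'.self_of_nhds (fderiv ℝ κ y a)]
  ring

end LocalGeometry

/-! ### The deformed Sasaki metric and the projection in coordinates. -/

section LocalBergerSasaki

variable {V : Type*} [NormedAddCommGroup V] [NormedSpace ℝ V]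

/-- In finite dimension a continuous linear map is the same as the finite tuple of its values on a
basis. -/
lemma contDiffAt_clm_of_apply [FiniteDimensional ℝ V] {W X : Type*} [NormedAddCommGroup W]
    [NormedSpace ℝ W] [NormedAddCommGroup X] [NormedSpace ℝ X] {n : WithTop ℕ∞}
    {f : X → V →L[ℝ] W} {x : X} (h : ∀ v, ContDiffAt ℝ n (fun y => f y v) x) :
    ContDiffAt ℝ n f x := by
  let d := Module.finrank ℝ V
  have hd : d = Module.finrank ℝ (Fin d → ℝ) := (Module.finrank_fin_fun ℝ).symm
  let e₁ := ContinuousLinearEquiv.ofFinrankEq hd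
  let e₂ := (e₁.arrowCongr (1 : W ≃L[ℝ] W)).trans (ContinuousLinearEquiv.piRing (Fin d))
  rw [← Function.id_comp f, ← e₂.symm_comp_self]
  exact e₂.symm.contDiff.contDiffAt.comp x (contDiffAt_pi.mpr fun i => h _)

/-- The connection map of the Levi-Civita connection of `G`, in coordinates. -/
def connectionMapLocal (G : V → V →L[ℝ] V →L[ℝ] ℝ) (z : V × V) : V × V →L[ℝ] V :=
  ContinuousLinearMap.snd ℝ V V + (christoffel G z.1).flip z.2 ∘L ContinuousLinearMap.fst ℝ V V

lemma connectionMapLocal_apply (G : V → V →L[ℝ] V →L[ℝ] ℝ) (z A : V × V) :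
    connectionMapLocal G z A = A.2 + christoffel G z.1 A.1 z.2 := rfl

/-- The Berger type deformed fibre metric. -/
def fiberMetric (B : V →L[ℝ] V →L[ℝ] ℝ) (δ : ℝ) (w k l : V) : ℝ :=
  B k l + δ ^ 2 * (B w k * B w l)

/-- The Berger type deformed Sasaki metric of `G` and `Φ`, in coordinates. -/
def bergerSasakiLocal (G : V → V →L[ℝ] V →L[ℝ] ℝ) (Φ : V → V →L[ℝ] V) (δ : ℝ) (z : V × V) :
    V × V →L[ℝ] V × V →L[ℝ] ℝ :=
  let θ : V × V →L[ℝ] ℝ := G z.1 (Φ z.1 z.2) ∘L connectionMapLocal G z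
  (G z.1).bilinearComp (ContinuousLinearMap.fst ℝ V V) (ContinuousLinearMap.fst ℝ V V) +
    (G z.1).bilinearComp (connectionMapLocal G z) (connectionMapLocal G z) +
    δ ^ 2 • θ.smulRight θ

lemma bergerSasakiLocal_apply (G : V → V →L[ℝ] V →L[ℝ] ℝ) (Φ : V → V →L[ℝ] V) (δ : ℝ)
    (z A B : V × V) :
    bergerSasakiLocal G Φ δ z A B = G z.1 A.1 B.1 +
      fiberMetric (G z.1) δ (Φ z.1 z.2) (connectionMapLocal G z A) (connectionMapLocal G z B) := by
  simp [bergerSasakiLocal, fiberMetric, add_assoc]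

lemma bergerSasakiLocal_symm {G : V → V →L[ℝ] V →L[ℝ] ℝ} (Φ : V → V →L[ℝ] V) (δ : ℝ)
    {z : V × V} (hs : ∀ b c, G z.1 b c = G z.1 c b) (A B : V × V) :
    bergerSasakiLocal G Φ δ z A B = bergerSasakiLocal G Φ δ z B A := by
  rw [bergerSasakiLocal_apply, bergerSasakiLocal_apply, fiberMetric, fiberMetric, hs A.1,
    hs (connectionMapLocal G z A) (connectionMapLocal G z B)]
  ring

lemma fiberMetric_pos {B : V →L[ℝ] V →L[ℝ] ℝ} (hB : ∀ v, v ≠ 0 → 0 < B v v) (δ : ℝ) (w k : V)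
    (hk : k ≠ 0) : 0 < fiberMetric B δ w k k := by
  have := hB k hk
  have := mul_self_nonneg (B w k)
  unfold fiberMetric
  positivity

lemma bergerSasakiLocal_pos {G : V → V →L[ℝ] V →L[ℝ] ℝ} (Φ : V → V →L[ℝ] V) (δ : ℝ)
    {z : V × V} (hG : ∀ v, v ≠ 0 → 0 < G z.1 v v) (A : V × V) (hA : A ≠ 0) :
    0 < bergerSasakiLocal G Φ δ z A A := by
  rw [bergerSasakiLocal_apply]
  by_cases h1 : A.1 = 0
  · have h2 : connectionMapLocal G z A ≠ 0 := by
      rw [connectionMapLocal_apply, h1]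
      intro h
      exact hA (Prod.ext h1 (by simpa using h))
    simpa [h1] using fiberMetric_pos hG δ _ _ h2
  · have h3 : 0 ≤ fiberMetric (G z.1) δ (Φ z.1 z.2) (connectionMapLocal G z A)
        (connectionMapLocal G z A) := by
      by_cases hk : connectionMapLocal G z A = 0
      · simp [hk, fiberMetric]
      · exact (fiberMetric_pos hG δ _ _ hk).le
    linarith [hG _ h1]

lemma contDiffAt_bergerSasakiLocal [FiniteDimensional ℝ V] {G : V → V →L[ℝ] V →L[ℝ] ℝ}
    {Φ : V → V →L[ℝ] V} (δ : ℝ) {z : V × V} (hG : ContDiffAt ℝ ∞ G z.1)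
    (hΓ : ContDiffAt ℝ ∞ (christoffel G) z.1)
    (hΦ : ContDiffAt ℝ ∞ Φ z.1) : ContDiffAt ℝ ∞ (bergerSasakiLocal G Φ δ) z := by
  have hG1 : ContDiffAt ℝ ∞ (fun w : V × V => G w.1) z := hG.comp z contDiffAt_fst
  have hΓ1 : ContDiffAt ℝ ∞ (fun w : V × V => christoffel G w.1) z := hΓ.comp z contDiffAt_fst
  have hΦ1 : ContDiffAt ℝ ∞ (fun w : V × V => Φ w.1) z := hΦ.comp z contDiffAt_fst
  have hK : ∀ A, ContDiffAt ℝ ∞ (fun w : V × V => connectionMapLocal G w A) z := fun A =>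
    contDiffAt_const.add ((hΓ1.clm_apply contDiffAt_const).clm_apply contDiffAt_snd)
  have hu := hΦ1.clm_apply contDiffAt_snd
  have h : ∀ A B, ContDiffAt ℝ ∞ (fun w => bergerSasakiLocal G Φ δ w A B) z := by
    intro A B
    simp only [bergerSasakiLocal_apply, fiberMetric]
    exact ((hG1.clm_apply contDiffAt_const).clm_apply contDiffAt_const).add
      (((hG1.clm_apply (hK A)).clm_apply (hK B)).add (contDiffAt_const.mul
        (((hG1.clm_apply hu).clm_apply (hK A)).mul ((hG1.clm_apply hu).clm_apply (hK B)))))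
  exact contDiffAt_clm_of_apply fun A => contDiffAt_clm_of_apply fun B => h A B

variable {G : V → V →L[ℝ] V →L[ℝ] ℝ} {Φ : V → V →L[ℝ] V} {δ : ℝ}

/-- The derivative of the deformed Sasaki metric, in coordinates. -/
lemma fderiv_bergerSasakiLocal {z : V × V} (hd : DifferentiableAt ℝ G z.1)
    (hΓ : DifferentiableAt ℝ (christoffel G) z.1) (hΦ : DifferentiableAt ℝ Φ z.1)
    (hB : DifferentiableAt ℝ (bergerSasakiLocal G Φ δ) z) (C A B : V × V) :
    fderiv ℝ (bergerSasakiLocal G Φ δ) z C A B =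
      fderiv ℝ G z.1 C.1 A.1 B.1 +
      (fderiv ℝ G z.1 C.1 (connectionMapLocal G z A) (connectionMapLocal G z B) +
        δ ^ 2 * ((fderiv ℝ G z.1 C.1 (Φ z.1 z.2) (connectionMapLocal G z A) +
            G z.1 (fderiv ℝ Φ z.1 C.1 z.2 + Φ z.1 C.2) (connectionMapLocal G z A)) *
              G z.1 (Φ z.1 z.2) (connectionMapLocal G z B) +
          G z.1 (Φ z.1 z.2) (connectionMapLocal G z A) *
            (fderiv ℝ G z.1 C.1 (Φ z.1 z.2) (connectionMapLocal G z B) +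
            G z.1 (fderiv ℝ Φ z.1 C.1 z.2 + Φ z.1 C.2) (connectionMapLocal G z B)))) +
      fiberMetric (G z.1) δ (Φ z.1 z.2)
        (fderiv ℝ (christoffel G) z.1 C.1 A.1 z.2 + christoffel G z.1 A.1 C.2)
        (connectionMapLocal G z B) +
      fiberMetric (G z.1) δ (Φ z.1 z.2) (connectionMapLocal G z A)
        (fderiv ℝ (christoffel G) z.1 C.1 B.1 z.2 + christoffel G z.1 B.1 C.2) := by
  rw [fderiv_apply₂_eq hB]
  have hfst : HasFDerivAt (Prod.fst : V × V → V) (ContinuousLinearMap.fst ℝ V V) z := hasFDerivAt_fst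
  have hsnd : HasFDerivAt (Prod.snd : V × V → V) (ContinuousLinearMap.snd ℝ V V) z := hasFDerivAt_snd
  have hG1 : HasFDerivAt (fun w : V × V => G w.1) _ z := hd.hasFDerivAt.comp z hfst
  have hΓ1 : HasFDerivAt (fun w : V × V => christoffel G w.1) _ z := hΓ.hasFDerivAt.comp z hfst
  have hΦ1 : HasFDerivAt (fun w : V × V => Φ w.1) _ z := hΦ.hasFDerivAt.comp z hfst
  have hK : ∀ A : V × V, HasFDerivAt (fun w : V × V => connectionMapLocal G w A) _ z := fun A =>
    (hasFDerivAt_const A.2 z).add ((hΓ1.clm_apply (hasFDerivAt_const A.1 z)).clm_apply hsnd)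
  have hu := hΦ1.clm_apply hsnd
  have h0 := ((hG1.clm_apply (hasFDerivAt_const A.1 z)).clm_apply (hasFDerivAt_const B.1 z)).add
      (((hG1.clm_apply (hK A)).clm_apply (hK B)).add
        ((((hG1.clm_apply hu).clm_apply (hK A)).mul ((hG1.clm_apply hu).clm_apply (hK B))).const_mul
          (δ ^ 2)))
  have h1 : (fun w => bergerSasakiLocal G Φ δ w A B) = fun w => G w.1 A.1 B.1 +
      (G w.1 (connectionMapLocal G w A) (connectionMapLocal G w B) +
        δ ^ 2 * (G w.1 (Φ w.1 w.2) (connectionMapLocal G w A) *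
          G w.1 (Φ w.1 w.2) (connectionMapLocal G w B))) := by
    funext w
    rw [bergerSasakiLocal_apply, fiberMetric]
  have h2 := congrArg (fun L : V × V →L[ℝ] ℝ => L C) h0.fderiv
  rw [h1]
  refine h2.trans ?_
  simp [fiberMetric]
  ring

/-- The first component of the Levi-Civita connection of the deformed Sasaki metric. -/
lemma inner_christoffel_bergerSasakiLocal {z : V × V} (hG : (G z.1).IsInvertible)
    (hs : ∀ᶠ y in 𝓝 z.1, ∀ b c, G y b c = G y c b)
    (hd : DifferentiableAt ℝ G z.1)
    (hΓ : DifferentiableAt ℝ (christoffel G) z.1) (hΦ : DifferentiableAt ℝ Φ z.1)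
    (hpar : ∀ a b, fderiv ℝ Φ z.1 a b + christoffel G z.1 a (Φ z.1 b) -
      Φ z.1 (christoffel G z.1 a b) = 0)
    (hB : DifferentiableAt ℝ (bergerSasakiLocal G Φ δ) z)
    (hBi : (bergerSasakiLocal G Φ δ z).IsInvertible) (A B : V × V) (c : V) :
    G z.1 (christoffel (bergerSasakiLocal G Φ δ) z A B).1 c = G z.1 (christoffel G z.1 A.1 B.1) c +
      (1 / 2 : ℝ) * (fiberMetric (G z.1) δ (Φ z.1 z.2) (connectionMapLocal G z B)
          (curvatureLocal G z.1 A.1 c z.2) +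
        fiberMetric (G z.1) δ (Φ z.1 z.2) (connectionMapLocal G z A)
          (curvatureLocal G z.1 B.1 c z.2)) := by
  obtain ⟨x, u⟩ := z
  obtain ⟨a, α⟩ := A
  obtain ⟨b, β⟩ := B
  -- The horizontal lift of c. The connection map kills it, so pairing with it under the deformed
  -- metric only sees first components.
  set C : V × V := (c, -christoffel G x c u) with hC
  have hKC : connectionMapLocal G (x, u) C = 0 := by
    simp [connectionMapLocal_apply, hC]
  have h1 : G x (christoffel (bergerSasakiLocal G Φ δ) (x, u) (a, α) (b, β)).1 c =
      bergerSasakiLocal G Φ δ (x, u)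
        (christoffel (bergerSasakiLocal G Φ δ) (x, u) (a, α) (b, β)) C := by
    rw [bergerSasakiLocal_apply, hKC]
    simp [fiberMetric, hC]
  have hpar' : ∀ a, fderiv ℝ Φ x a u = Φ x (christoffel G x a u) - christoffel G x a (Φ x u) := by
    intro a
    have := hpar a u
    simp only at this
    rw [← sub_eq_zero, ← this]
    abel
  have hsy := hs.self_of_nhds
  have hΓs := christoffel_symm hG hd hs
  simp only at hd hΓ hΦ hG hsy hΓs ⊢
  rw [h1, inner_christoffel hBi, fderiv_bergerSasakiLocal hd hΓ hΦ hB,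
    fderiv_bergerSasakiLocal hd hΓ hΦ hB, fderiv_bergerSasakiLocal hd hΓ hΦ hB, hKC,
    inner_christoffel hG]
  set kA := connectionMapLocal G (x, u) (a, α) with hkA
  set kB := connectionMapLocal G (x, u) (b, β) with hkB
  -- Only here does curvature enter: differentiating the coefficient Γ(c, u) along (a', α') and the
  -- coefficient Γ(a', u) along the horizontal lift `C` gives results that differ by R(a', c)u and a
  -- Christoffel term in the vertical part.
  have hcurv : ∀ a' α', fderiv ℝ (christoffel G) x a' c u + christoffel G x c α' =
      curvatureLocal G x a' c u +
        (fderiv ℝ (christoffel G) x c a' u + christoffel G x a' C.2) +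
        christoffel G x c (connectionMapLocal G (x, u) (a', α')) := by
    intro a' α'
    simp only [curvatureLocal, connectionMapLocal_apply, hC, map_add, map_neg]
    abel
  -- Since ∇Φ = 0, the vector Φu is parallel along the horizontal direction `C`, so the derivative
  -- of g(Φu, k) only retains the Christoffel term acting on k.
  have hθ : ∀ k, fderiv ℝ G x c (Φ x u) k + G x (fderiv ℝ Φ x c u + Φ x C.2) k =
      G x (Φ x u) (christoffel G x c k) := by
    intro k
    rw [fderiv_metric_eq hG hd hs, hpar']
    simp only [hC, map_add, map_sub, map_neg, add_apply, sub_apply, neg_apply]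
    ring
  have hCc : C.1 = c := rfl
  simp only [hCc, hθ, hcurv, map_zero]
  rw [← hkA, ← hkB, fderiv_metric_eq hG hd hs c kA kB]
  set QA := fderiv ℝ (christoffel G) x c a u + christoffel G x a C.2
  set QB := fderiv ℝ (christoffel G) x c b u + christoffel G x b C.2
  simp only [fiberMetric, map_add, map_zero, mul_zero, add_zero]
  rw [hsy QA kB, hsy (christoffel G x c kA) kB]
  ring

/-- A bilinear form that is anti-invariant under an isometric involution is trace free. -/
lemma sum_inverse_mul_eq_zero_of_involution {W ι : Type*} [NormedAddCommGroup W] [NormedSpace ℝ W]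
    [FiniteDimensional ℝ W] [Fintype ι] (e : Module.Basis ι ℝ W)
    {B : W →L[ℝ] W →L[ℝ] ℝ} (hB : B.IsInvertible) (β : W →ₗ[ℝ] W →ₗ[ℝ] ℝ) (σ : W →ₗ[ℝ] W)
    (hσ : ∀ x, σ (σ x) = x) (hiso : ∀ x y, B (σ x) (σ y) = B x y)
    (hβ : ∀ x y, β (σ x) (σ y) = -β x y) :
    ∑ i, ∑ j, e.coord i (B.inverse (LinearMap.toContinuousLinearMap (e.coord j))) * β (e i) (e j)
      = 0 := by
  classical
  -- β with one index raised by `B`; the double sum is the trace of this endomorphism, hence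
  -- independent of the basis.
  let P : W →ₗ[ℝ] W := (B.inverse : (W →L[ℝ] ℝ) →ₗ[ℝ] W) ∘ₗ
    (LinearMap.toContinuousLinearMap : (W →ₗ[ℝ] ℝ) ≃ₗ[ℝ] (W →L[ℝ] ℝ)).toLinearMap ∘ₗ β
  have hP : ∀ x y, B (P x) y = β x y := fun x y => by
    have : B (P x) = LinearMap.toContinuousLinearMap (β x) := inner_inverse_apply hB _
    rw [this]
    rfl
  have htrace : LinearMap.trace ℝ W P = ∑ i, ∑ j,
      e.coord i (B.inverse (LinearMap.toContinuousLinearMap (e.coord j))) * β (e i) (e j) := by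
    rw [LinearMap.trace_eq_matrix_trace ℝ e, Matrix.trace]
    refine Finset.sum_congr rfl fun i _ => ?_
    have hexp : β (e i) = ∑ j, β (e i) (e j) • e.coord j := by
      refine e.ext fun k => ?_
      simp
    have hPe : P (e i) = ∑ j, β (e i) (e j) •
        B.inverse (LinearMap.toContinuousLinearMap (e.coord j)) := by
      have h1 : P (e i) = B.inverse (LinearMap.toContinuousLinearMap (β (e i))) := rfl
      rw [h1, hexp]
      simp only [map_sum, map_smul]
      simp
    rw [Matrix.diag_apply, LinearMap.toMatrix_apply, hPe, ← Module.Basis.coord_apply, map_sum]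
    refine Finset.sum_congr rfl fun j _ => ?_
    rw [map_smul, smul_eq_mul, mul_comm]
  rw [← htrace]
  -- σ is an isometric involution, so it is self-adjoint for `B` and the sign of β passes to `P`.
  -- Cyclicity of the trace then gives tr P = -tr P.
  have hconj : σ ∘ₗ P ∘ₗ σ = -P := by
    ext x
    refine inner_eq_imp hB fun c => ?_
    have h1 : B (σ (P (σ x))) c = B (P (σ x)) (σ c) := by
      rw [← hiso (P (σ x)), hσ]
    simp [h1, hP, hβ]
  have h1 : LinearMap.trace ℝ W (σ ∘ₗ P ∘ₗ σ) = LinearMap.trace ℝ W P := by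
    rw [LinearMap.trace_comp_comm', LinearMap.comp_assoc]
    congr 1
    ext x
    simp [hσ]
  rw [hconj, map_neg] at h1
  linarith

/-- The second fundamental form of the projection `V × V → V` for the deformed Sasaki metric. -/
def secondFundamentalFormLocal (G : V → V →L[ℝ] V →L[ℝ] ℝ) (Φ : V → V →L[ℝ] V) (δ : ℝ)
    (z A B : V × V) : V :=
  -(christoffel (bergerSasakiLocal G Φ δ) z A B).1 + christoffel G z.1 A.1 B.1

/-- Regularity of the data `G` and `Φ` at a point, and `∇Φ = 0` at this point. -/
structure IsParallelAt (G : V → V →L[ℝ] V →L[ℝ] ℝ) (Φ : V → V →L[ℝ] V) (x : V) : Prop where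
  pos : ∀ v, v ≠ 0 → 0 < G x v v
  symm : ∀ᶠ y in 𝓝 x, ∀ b c, G y b c = G y c b
  contDiffAt_metric : ContDiffAt ℝ ∞ G x
  contDiffAt_endo : ContDiffAt ℝ ∞ Φ x
  parallel : ∀ a b, fderiv ℝ Φ x a b + christoffel G x a (Φ x b) - Φ x (christoffel G x a b) = 0

variable [FiniteDimensional ℝ V]

lemma IsParallelAt.contDiffAt_bergerSasakiLocal {x : V} (h : IsParallelAt G Φ x) (δ : ℝ) (u : V) :
    ContDiffAt ℝ ∞ (bergerSasakiLocal G Φ δ) (x, u) :=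
  BergerSasaki.contDiffAt_bergerSasakiLocal δ h.contDiffAt_metric
    (contDiffAt_christoffel (isInvertible_of_pos h.pos) h.contDiffAt_metric) h.contDiffAt_endo

lemma IsParallelAt.inner_secondFundamentalFormLocal {x : V} (h : IsParallelAt G Φ x) (u : V)
    (A B : V × V) (c : V) :
    G x (secondFundamentalFormLocal G Φ δ (x, u) A B) c =
      -(1 / 2 : ℝ) * (fiberMetric (G x) δ (Φ x u) (connectionMapLocal G (x, u) B)
          (curvatureLocal G x A.1 c u) +
        fiberMetric (G x) δ (Φ x u) (connectionMapLocal G (x, u) A)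
          (curvatureLocal G x B.1 c u)) := by
  have hG := isInvertible_of_pos h.pos
  have := inner_christoffel_bergerSasakiLocal (δ := δ) (z := (x, u)) hG h.symm
    (h.contDiffAt_metric.differentiableAt (by simp))
    ((contDiffAt_christoffel hG h.contDiffAt_metric).differentiableAt (by simp))
    (h.contDiffAt_endo.differentiableAt (by simp)) h.parallel
    ((h.contDiffAt_bergerSasakiLocal δ u).differentiableAt (by simp))
    (isInvertible_of_pos (bergerSasakiLocal_pos Φ δ h.pos)) A B c
  simp only at this
  rw [secondFundamentalFormLocal, map_add, map_neg, add_apply, neg_apply, this]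
  ring

lemma IsParallelAt.secondFundamentalFormLocal_eq_zero_iff {x : V} (h : IsParallelAt G Φ x) :
    (∀ u A B, secondFundamentalFormLocal G Φ δ (x, u) A B = 0) ↔
      ∀ a b c, curvatureLocal G x a b c = 0 := by
  constructor
  · intro h0 b c u
    by_contra hne
    -- The vertical lift of R(b, c)u against the horizontal lift of b: one curvature term drops out
    -- and the other is the fibre norm of R(b, c)u.
    have h1 := h.inner_secondFundamentalFormLocal (δ := δ) u
      (0, curvatureLocal G x b c u) (b, -christoffel G x b u) c
    have hz : connectionMapLocal G (x, u) (b, -christoffel G x b u) = 0 := by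
      simp [connectionMapLocal_apply]
    have hv : connectionMapLocal G (x, u) (0, curvatureLocal G x b c u) =
        curvatureLocal G x b c u := by
      simp [connectionMapLocal_apply]
    have hf : ∀ w k, fiberMetric (G x) δ w 0 k = 0 := by simp [fiberMetric]
    rw [h0, hz, hv, hf, map_zero, zero_apply] at h1
    have := fiberMetric_pos h.pos δ (Φ x u) _ hne
    linarith
  · intro hR u A B
    refine inner_eq_imp (isInvertible_of_pos h.pos) fun c => ?_
    rw [h.inner_secondFundamentalFormLocal, hR, hR]
    simp [fiberMetric]

/-- Each term of the curvature formula contains one connection map and one base component, so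
reversing vertical vectors changes the sign of the form and leaves the metric unchanged. -/
lemma IsParallelAt.sum_secondFundamentalFormLocal_eq_zero {x : V} (h : IsParallelAt G Φ x) (u : V)
    {ι : Type*} [Fintype ι] (e : Module.Basis ι ℝ (V × V)) :
    ∑ i, ∑ j, e.coord i ((bergerSasakiLocal G Φ δ (x, u)).inverse
      (LinearMap.toContinuousLinearMap (e.coord j))) •
        secondFundamentalFormLocal G Φ δ (x, u) (e i) (e j) = 0 := by
  refine inner_eq_imp (isInvertible_of_pos h.pos) fun c => ?_
  simp only [map_sum, map_smul, sum_apply, smul_apply, smul_eq_mul, map_zero, zero_apply]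
  let β : V × V →ₗ[ℝ] V × V →ₗ[ℝ] ℝ := LinearMap.mk₂ ℝ
    (fun A B => G x (secondFundamentalFormLocal G Φ δ (x, u) A B) c)
    (fun A A' B => by simp [secondFundamentalFormLocal]; ring)
    (fun r A B => by simp [secondFundamentalFormLocal]; ring)
    (fun A B B' => by simp [secondFundamentalFormLocal]; ring)
    (fun r A B => by simp [secondFundamentalFormLocal]; ring)
  -- Identity on horizontal vectors and -1 on vertical ones. The coefficient 2 is what makes K ∘ σ =
  -- -K while first components are kept.
  let σ : V × V →ₗ[ℝ] V × V := (LinearMap.fst ℝ V V).prod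
    (-LinearMap.snd ℝ V V -
      (2 : ℝ) • ((christoffel G x).flip u : V →ₗ[ℝ] V) ∘ₗ LinearMap.fst ℝ V V)
  have hσ1 : ∀ A, (σ A).1 = A.1 := fun A => rfl
  have hσ2 : ∀ A, (σ A).2 = -A.2 - (2 : ℝ) • christoffel G x A.1 u := fun A => rfl
  have hσK : ∀ A, connectionMapLocal G (x, u) (σ A) = -connectionMapLocal G (x, u) A := by
    intro A
    rw [connectionMapLocal_apply, connectionMapLocal_apply, hσ1, hσ2]
    module
  have hneg : ∀ w k l, fiberMetric (G x) δ w (-k) l = -fiberMetric (G x) δ w k l := by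
    intro w k l
    simp [fiberMetric]
    ring
  have hneg' : ∀ w k l, fiberMetric (G x) δ w (-k) (-l) = fiberMetric (G x) δ w k l := by
    intro w k l
    simp [fiberMetric]
  refine sum_inverse_mul_eq_zero_of_involution e
    (isInvertible_of_pos (bergerSasakiLocal_pos (z := (x, u)) Φ δ h.pos)) β σ ?_ ?_ ?_
  · intro A
    refine Prod.ext rfl ?_
    rw [hσ2, hσ2, hσ1]
    module
  · intro A B
    simp only [bergerSasakiLocal_apply, hσK, hσ1, hneg']
  · intro A B
    simp only [β, LinearMap.mk₂_apply, h.inner_secondFundamentalFormLocal, hσK, hσ1, hneg]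
    ring

end LocalBergerSasaki

/-! ### Tensors and transition maps in charts of the base. -/

section Charts

variable {E : Type*} [NormedAddCommGroup E] [NormedSpace ℝ E]
  {H : Type*} [TopologicalSpace H] (I : ModelWithCorners ℝ E H)
  {M : Type*} [TopologicalSpace M] [ChartedSpace H M]

lemma metricInChart_apply (h : ∀ q : M, TangentSpace I q →L[ℝ] TangentSpace I q →L[ℝ] ℝ)
    (p : M) (y b c : E) :
    metricInChart I h p y b c = (h ((extChartAt I p).symm y) : E →L[ℝ] E →L[ℝ] ℝ)
      ((mfderiv 𝓘(ℝ, E) I (extChartAt I p).symm y : E →L[ℝ] E) b)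
      ((mfderiv 𝓘(ℝ, E) I (extChartAt I p).symm y : E →L[ℝ] E) c) := rfl

variable [I.Boundaryless]

lemma contMDiffAt_iff_contDiffAt_comp_symm {F : Type*} [NormedAddCommGroup F] [NormedSpace ℝ F]
    {f : M → F} {p : M} :
    ContMDiffAt I 𝓘(ℝ, F) ∞ f p ↔
      ContDiffAt ℝ ∞ (fun y => f ((extChartAt I p).symm y)) (extChartAt I p p) := by
  rw [contMDiffAt_iff_source, I.range_eq_univ, contMDiffWithinAt_univ, contMDiffAt_iff_contDiffAt]
  rfl

variable [IsManifold I ∞ M]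

lemma symm_trivializationAt_apply {p : M} {y : E} (hy : y ∈ (extChartAt I p).target) (a : E) :
    (trivializationAt E (TangentSpace I) p).symm ((extChartAt I p).symm y) a =
      (mfderiv 𝓘(ℝ, E) I (extChartAt I p).symm y : E →L[ℝ] E) a := by
  have hq : (extChartAt I p).symm y ∈ (chartAt H p).source := by
    rw [← extChartAt_source I]
    exact (extChartAt I p).map_target hy
  have h1 := TangentBundle.symmL_trivializationAt (𝕜 := ℝ) (I := I) hq
  rw [(extChartAt I p).right_inv hy, I.range_eq_univ, mfderivWithin_univ] at h1
  exact (Bundle.Trivialization.symmL_apply (R := ℝ) _ hq a).symm.trans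
    (congrArg (fun L : E →L[ℝ] E => L a) h1)

/-- The trivialization of the tangent bundle centred at p is induced by the chart at p, so near p
the bundle coordinates of the form are its chart components. It is used on M to extract smoothness
and on TM to prove it. -/
lemma contMDiffAt_metric_iff
    (h : ∀ q : M, TangentSpace I q →L[ℝ] TangentSpace I q →L[ℝ] ℝ) (p : M) :
    ContMDiffAt I (I.prod 𝓘(ℝ, E →L[ℝ] E →L[ℝ] ℝ)) ∞
      (fun q ↦ Bundle.TotalSpace.mk' (E →L[ℝ] E →L[ℝ] ℝ)
        (E := fun q : M ↦ TangentSpace I q →L[ℝ] TangentSpace I q →L[ℝ] ℝ) q (h q)) p ↔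
    ContDiffAt ℝ ∞ (metricInChart I h p) (extChartAt I p p) := by
  rw [contMDiffAt_hom_bundle, contMDiffAt_iff_contDiffAt_comp_symm]
  refine (and_iff_right contMDiffAt_id).trans ?_
  suffices hev : _ =ᶠ[𝓝 (extChartAt I p p)] metricInChart I h p from
    ⟨fun hf => hf.congr_of_eventuallyEq hev.symm, fun hf => hf.congr_of_eventuallyEq hev⟩
  filter_upwards [extChartAt_target_mem_nhds (I := I) p] with y hy
  have hq : (extChartAt I p).symm y ∈ (chartAt H p).source := by
    rw [← extChartAt_source I]
    exact (extChartAt I p).map_target hy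
  ext a b
  refine (inCoordinates_apply_eq₂ (E₁ := (TangentSpace I : M → Type _)) (F₁ := E)
    (E₂ := (TangentSpace I : M → Type _)) (F₂ := E) (E₃ := Bundle.Trivial M ℝ) (F₃ := ℝ)
    (ϕ := h ((extChartAt I p).symm y)) (v := a) (w := b) hq hq (Set.mem_univ _)).trans ?_
  rw [symm_trivializationAt_apply I hy, symm_trivializationAt_apply I hy]
  simp
  rfl

lemma contDiffAt_endoInChart {φ : ∀ q : M, TangentSpace I q →L[ℝ] TangentSpace I q} {p : M}
    (hφ : ContMDiffAt I (I.prod 𝓘(ℝ, E →L[ℝ] E)) ∞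
      (fun q ↦ Bundle.TotalSpace.mk' (E →L[ℝ] E)
        (E := fun q : M ↦ TangentSpace I q →L[ℝ] TangentSpace I q) q (φ q)) p) :
    ContDiffAt ℝ ∞ (endoInChart I φ p) (extChartAt I p p) := by
  rw [contMDiffAt_hom_bundle] at hφ
  have h2 := hφ.2
  rw [contMDiffAt_iff_contDiffAt_comp_symm] at h2
  refine h2.congr_of_eventuallyEq ?_
  filter_upwards [extChartAt_target_mem_nhds (I := I) p] with y hy
  have hq : (extChartAt I p).symm y ∈ (chartAt H p).source := by
    rw [← extChartAt_source I]
    exact (extChartAt I p).map_target hy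
  have h1 := TangentBundle.symmL_trivializationAt (𝕜 := ℝ) (I := I) hq
  rw [(extChartAt I p).right_inv hy, I.range_eq_univ, mfderivWithin_univ] at h1
  have h3 := TangentBundle.continuousLinearMapAt_trivializationAt (𝕜 := ℝ) (I := I) hq
  rw [endoInChart, ← h1, ← h3]
  rfl

lemma mfderiv_extChartAt_symm_self (p : M) :
    (mfderiv 𝓘(ℝ, E) I (extChartAt I p).symm (extChartAt I p p) : E →L[ℝ] E) =
      ContinuousLinearMap.id ℝ E := by
  rw [← mfderivWithin_univ, ← I.range_eq_univ]
  exact mfderivWithin_range_extChartAt_symm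

lemma mfderiv_extChartAt_symm_comp {p : M} {y : E} (hy : y ∈ (extChartAt I p).target) :
    (mfderiv 𝓘(ℝ, E) I (extChartAt I p).symm y : E →L[ℝ] E) ∘L
      (mfderiv I 𝓘(ℝ, E) (extChartAt I p) ((extChartAt I p).symm y) : E →L[ℝ] E) =
      ContinuousLinearMap.id ℝ E := by
  rw [← mfderivWithin_univ, ← I.range_eq_univ]
  exact mfderivWithin_extChartAt_symm_comp_mfderiv_extChartAt hy

lemma contDiffAt_transition {p q : M} {y : E}
    (hy : y ∈ (extChartAt I p).target) (hq : (extChartAt I p).symm y ∈ (extChartAt I q).source) :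
    ContDiffAt ℝ ∞ (fun z => extChartAt I q ((extChartAt I p).symm z)) y := by
  have h1 : ContMDiffAt 𝓘(ℝ, E) I ∞ (extChartAt I p).symm y :=
    (contMDiffOn_extChartAt_symm (I := I) (n := ∞) p).contMDiffAt (extChartAt_target_mem_nhds' hy)
  have h2 : ContMDiffAt I 𝓘(ℝ, E) ∞ (extChartAt I q) ((extChartAt I p).symm y) :=
    contMDiffAt_extChartAt' (by rwa [extChartAt_source] at hq)
  exact contMDiffAt_iff_contDiffAt.mp (h2.comp y h1)

/-- The components of a metric in two charts are related by the transition map. -/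
lemma metricInChart_eq_comp
    (h : ∀ q : M, TangentSpace I q →L[ℝ] TangentSpace I q →L[ℝ] ℝ) {p q : M} {y : E}
    (hy : y ∈ (extChartAt I p).target) (hq : (extChartAt I p).symm y ∈ (extChartAt I q).source)
    (b c : E) :
    metricInChart I h p y b c =
      metricInChart I h q (extChartAt I q ((extChartAt I p).symm y))
        (fderiv ℝ (fun z => extChartAt I q ((extChartAt I p).symm z)) y b)
        (fderiv ℝ (fun z => extChartAt I q ((extChartAt I p).symm z)) y c) := by
  set κ : E → E := fun z => extChartAt I q ((extChartAt I p).symm z) with hκ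
  have hκy : κ y ∈ (extChartAt I q).target := (extChartAt I q).map_source hq
  have hinv : (extChartAt I q).symm (κ y) = (extChartAt I p).symm y := (extChartAt I q).left_inv hq
  have hcont : ContinuousAt (extChartAt I p).symm y := continuousAt_extChartAt_symm'' hy
  have hev : (extChartAt I p).symm =ᶠ[𝓝 y] (extChartAt I q).symm ∘ κ := by
    filter_upwards [hcont.preimage_mem_nhds ((isOpen_extChartAt_source q).mem_nhds hq)] with z hz
    exact ((extChartAt I q).left_inv hz).symm
  have hκd : DifferentiableAt ℝ κ y := (contDiffAt_transition I hy hq).differentiableAt (by simp)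
  have hd : MDifferentiableAt 𝓘(ℝ, E) I (extChartAt I q).symm (κ y) := by
    have := mdifferentiableWithinAt_extChartAt_symm (I := I) hκy
    rwa [I.range_eq_univ, mdifferentiableWithinAt_univ] at this
  have hD : (mfderiv 𝓘(ℝ, E) I (extChartAt I p).symm y : E →L[ℝ] E) =
      (mfderiv 𝓘(ℝ, E) I (extChartAt I q).symm (κ y) : E →L[ℝ] E) ∘L fderiv ℝ κ y := by
    have h1 := hev.mfderiv_eq (I := 𝓘(ℝ, E)) (I' := I)
    have h2 := mfderiv_comp y hd hκd.mdifferentiableAt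
    rw [mfderiv_eq_fderiv] at h2
    exact h1.trans h2
  let h' : M → E →L[ℝ] E →L[ℝ] ℝ := h
  change h' ((extChartAt I p).symm y) ((mfderiv 𝓘(ℝ, E) I (extChartAt I p).symm y : E →L[ℝ] E) b)
      ((mfderiv 𝓘(ℝ, E) I (extChartAt I p).symm y : E →L[ℝ] E) c) =
    h' ((extChartAt I q).symm (κ y))
      ((mfderiv 𝓘(ℝ, E) I (extChartAt I q).symm (κ y) : E →L[ℝ] E) (fderiv ℝ κ y b))
      ((mfderiv 𝓘(ℝ, E) I (extChartAt I q).symm (κ y) : E →L[ℝ] E) (fderiv ℝ κ y c))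
  rw [hinv, hD]
  rfl

/-- The tangent space at q is the model space read through the preferred chart at q, so
differentiating an inverse chart means differentiating the transition to the chart at the image
point. -/
lemma mfderiv_extChartAt_symm_eq_fderiv {p : M} {y : E} (hy : y ∈ (extChartAt I p).target) :
    (mfderiv 𝓘(ℝ, E) I (extChartAt I p).symm y : E →L[ℝ] E) =
      fderiv ℝ (fun z => extChartAt I ((extChartAt I p).symm y) ((extChartAt I p).symm z)) y := by
  have hd : MDifferentiableAt 𝓘(ℝ, E) I (extChartAt I p).symm y := by
    have := mdifferentiableWithinAt_extChartAt_symm (I := I) hy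
    rwa [I.range_eq_univ, mdifferentiableWithinAt_univ] at this
  refine hd.mfderiv.trans ?_
  simp only [modelWithCornersSelf_coe, Set.range_id, fderivWithin_univ, writtenInExtChartAt,
    extChartAt_model_space_eq_id, PartialEquiv.refl_symm, PartialEquiv.refl_coe, Function.comp_id,
    id_eq]
  rfl

end Charts

/-! ### Induced charts of the tangent bundle. -/

section TangentBundleCharts

variable {E : Type*} [NormedAddCommGroup E] [NormedSpace ℝ E]
  {H : Type*} [TopologicalSpace H] (I : ModelWithCorners ℝ E H)
  {M : Type*} [TopologicalSpace M] [ChartedSpace H M] [IsManifold I ∞ M]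

lemma mem_extChartAt_tangent_target_iff (v : TangentBundle I M) (z : E × E) :
    z ∈ (extChartAt I.tangent v).target ↔ z.1 ∈ (extChartAt I v.proj).target := by
  rw [FiberBundle.extChartAt_target]
  simp only [Set.mem_prod, Set.mem_univ, and_true, Set.mem_inter_iff, and_iff_left_iff_imp]
  intro h
  rw [Set.mem_preimage, TangentBundle.trivializationAt_baseSet, ← extChartAt_source I]
  exact (extChartAt I v.proj).map_target h

lemma extChartAt_tangent_apply (w x : TangentBundle I M)
    (hx : x.proj ∈ (extChartAt I w.proj).source) :
    extChartAt I.tangent w x = (extChartAt I w.proj x.proj,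
      (mfderiv I 𝓘(ℝ, E) (extChartAt I w.proj) x.proj : E →L[ℝ] E) x.2) := by
  rw [extChartAt_source] at hx
  rw [← TangentBundle.continuousLinearMapAt_trivializationAt hx, FiberBundle.extChartAt]
  refine Prod.ext rfl ?_
  exact (congrFun (Bundle.Trivialization.coe_linearMapAt_of_mem (R := ℝ)
    (trivializationAt E (TangentSpace I) w.proj) hx) x.2).symm

variable [I.Boundaryless]

lemma extChartAt_tangent_symm_apply (v : TangentBundle I M) {z : E × E}
    (hz : z.1 ∈ (extChartAt I v.proj).target) :
    (extChartAt I.tangent v).symm z =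
      (⟨(extChartAt I v.proj).symm z.1,
        (mfderiv 𝓘(ℝ, E) I (extChartAt I v.proj).symm z.1 : E →L[ℝ] E) z.2⟩ :
          TangentBundle I M) := by
  have hq : (extChartAt I v.proj).symm z.1 ∈ (chartAt H v.proj).source := by
    rw [← extChartAt_source I]
    exact (extChartAt I v.proj).map_target hz
  rw [← symm_trivializationAt_apply I hz, FiberBundle.extChartAt]
  exact (Bundle.Trivialization.mk_symm (trivializationAt E (TangentSpace I) v.proj) hq z.2).symm

lemma fderiv_transition_apply {p q : M} {y : E} (hy : y ∈ (extChartAt I p).target)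
    (hq : (extChartAt I p).symm y ∈ (extChartAt I q).source) (u : E) :
    fderiv ℝ (fun z => extChartAt I q ((extChartAt I p).symm z)) y u =
      (mfderiv I 𝓘(ℝ, E) (extChartAt I q) ((extChartAt I p).symm y) : E →L[ℝ] E)
        ((mfderiv 𝓘(ℝ, E) I (extChartAt I p).symm y : E →L[ℝ] E) u) := by
  have hd : MDifferentiableAt 𝓘(ℝ, E) I (extChartAt I p).symm y := by
    have := mdifferentiableWithinAt_extChartAt_symm (I := I) hy
    rwa [I.range_eq_univ, mdifferentiableWithinAt_univ] at this
  have hd' : MDifferentiableAt I 𝓘(ℝ, E) (extChartAt I q) ((extChartAt I p).symm y) :=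
    mdifferentiableAt_extChartAt (by rwa [extChartAt_source] at hq)
  have h := mfderiv_comp y hd' hd
  rw [mfderiv_eq_fderiv] at h
  exact congrArg (fun L : E →L[ℝ] E => L u) h

/-- The transition maps of the tangent bundle are the tangent maps of the transition maps. -/
lemma tangent_transition_apply (v w : TangentBundle I M) {z : E × E}
    (hz : z.1 ∈ (extChartAt I v.proj).target)
    (hw : (extChartAt I v.proj).symm z.1 ∈ (extChartAt I w.proj).source) :
    extChartAt I.tangent w ((extChartAt I.tangent v).symm z) =
      (extChartAt I w.proj ((extChartAt I v.proj).symm z.1),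
        fderiv ℝ (fun y => extChartAt I w.proj ((extChartAt I v.proj).symm y)) z.1 z.2) := by
  rw [extChartAt_tangent_symm_apply I v hz, extChartAt_tangent_apply I w _ hw,
    fderiv_transition_apply I hz hw]
  rfl

/-- Differentiates (y, u) ↦ (κ y, dκ_y u). The second derivative of κ in the fibre component is the
term that the Christoffel symbols must compensate. -/
lemma fderiv_tangent_transition (v w : TangentBundle I M) {z : E × E}
    (hz : z.1 ∈ (extChartAt I v.proj).target)
    (hw : (extChartAt I v.proj).symm z.1 ∈ (extChartAt I w.proj).source) (A : E × E) :
    fderiv ℝ (fun z => extChartAt I.tangent w ((extChartAt I.tangent v).symm z)) z A =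
      (fderiv ℝ (fun y => extChartAt I w.proj ((extChartAt I v.proj).symm y)) z.1 A.1,
        fderiv ℝ (fun y => extChartAt I w.proj ((extChartAt I v.proj).symm y)) z.1 A.2 +
        fderiv ℝ (fderiv ℝ (fun y => extChartAt I w.proj ((extChartAt I v.proj).symm y)))
          z.1 A.1 z.2) := by
  set κ : E → E := fun y => extChartAt I w.proj ((extChartAt I v.proj).symm y) with hκ
  have hκs : ContDiffAt ℝ ∞ κ z.1 := contDiffAt_transition I hz hw
  have hcont : ContinuousAt (extChartAt I v.proj).symm z.1 := continuousAt_extChartAt_symm'' hz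
  have hev : (fun z => extChartAt I.tangent w ((extChartAt I.tangent v).symm z)) =ᶠ[𝓝 z]
      fun z : E × E => (κ z.1, fderiv ℝ κ z.1 z.2) := by
    have h1 : ∀ᶠ y in 𝓝 z.1, y ∈ (extChartAt I v.proj).target ∧
        (extChartAt I v.proj).symm y ∈ (extChartAt I w.proj).source :=
      Filter.Eventually.and (extChartAt_target_mem_nhds' hz)
        (hcont.preimage_mem_nhds ((isOpen_extChartAt_source w.proj).mem_nhds hw))
    filter_upwards [continuousAt_fst.eventually h1] with x hx
    exact tangent_transition_apply I v w hx.1 hx.2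
  have hfst : HasFDerivAt (Prod.fst : E × E → E) (ContinuousLinearMap.fst ℝ E E) z := hasFDerivAt_fst
  have hsnd : HasFDerivAt (Prod.snd : E × E → E) (ContinuousLinearMap.snd ℝ E E) z := hasFDerivAt_snd
  have h1 : HasFDerivAt (fun z : E × E => κ z.1) _ z :=
    (hκs.differentiableAt (by simp)).hasFDerivAt.comp z hfst
  have h2 : HasFDerivAt (fun z : E × E => fderiv ℝ κ z.1) _ z :=
    ((hκs.fderiv_right (m := ∞) (by simp)).differentiableAt (by simp)).hasFDerivAt.comp z hfst
  rw [hev.fderiv_eq, (h1.prodMk (h2.clm_apply hsnd)).fderiv]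
  simp

end TangentBundleCharts

/-! ### Components of the metrics in a fixed chart, away from its centre. -/

section MetricInChart

variable {E : Type*} [NormedAddCommGroup E] [NormedSpace ℝ E]
  {H : Type*} [TopologicalSpace H] (I : ModelWithCorners ℝ E H)
  {M : Type*} [TopologicalSpace M] [ChartedSpace H M] [IsManifold I ∞ M]
  (g : Bundle.ContMDiffRiemannianMetric I ∞ E (TangentSpace I : M → Type _))
  (φ : ∀ q : M, TangentSpace I q →L[ℝ] TangentSpace I q)

lemma metricInChart_symm (p : M) (y b c : E) :
    metricInChart I g.inner p y b c = metricInChart I g.inner p y c b := by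
  rw [metricInChart_apply, metricInChart_apply]
  exact g.symm _ _ _

variable [I.Boundaryless]

lemma metricInChart_pos {p : M} {y : E} (hy : y ∈ (extChartAt I p).target) (b : E) (hb : b ≠ 0) :
    0 < metricInChart I g.inner p y b b := by
  rw [metricInChart_apply]
  refine g.pos _ _ fun h => hb ?_
  have h1 := isInvertible_mfderivWithin_extChartAt_symm (I := I) hy
  rw [I.range_eq_univ, mfderivWithin_univ] at h1
  exact h1.injective (h.trans (map_zero _).symm)

lemma metricInChart_self (h : ∀ q : M, TangentSpace I q →L[ℝ] TangentSpace I q →L[ℝ] ℝ) (p : M) :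
    metricInChart I h p (extChartAt I p p) = h p := by
  let h' : M → E →L[ℝ] E →L[ℝ] ℝ := h
  refine ContinuousLinearMap.ext fun b => ContinuousLinearMap.ext fun c => ?_
  change h' ((extChartAt I p).symm (extChartAt I p p))
    ((mfderiv 𝓘(ℝ, E) I (extChartAt I p).symm (extChartAt I p p) : E →L[ℝ] E) b)
    ((mfderiv 𝓘(ℝ, E) I (extChartAt I p).symm (extChartAt I p p) : E →L[ℝ] E) c) = h' p b c
  rw [mfderiv_extChartAt_symm_self, (extChartAt I p).left_inv (mem_extChartAt_source p)]
  rfl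

lemma endoInChart_self (p : M) : endoInChart I φ p (extChartAt I p p) = φ p := by
  let φ' : M → E →L[ℝ] E := φ
  let D : M → E →L[ℝ] E := fun q => mfderiv I 𝓘(ℝ, E) (extChartAt I p) q
  have hD : D p = ContinuousLinearMap.id ℝ E := mfderiv_extChartAt_self
  change D ((extChartAt I p).symm (extChartAt I p p)) ∘L
    φ' ((extChartAt I p).symm (extChartAt I p p)) ∘L
    (mfderiv 𝓘(ℝ, E) I (extChartAt I p).symm (extChartAt I p p) : E →L[ℝ] E) = φ' p
  rw [mfderiv_extChartAt_symm_self, (extChartAt I p).left_inv (mem_extChartAt_source p), hD]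
  rfl

lemma mfderiv_extChartAt_symm_endoInChart {p : M} {y : E} (hy : y ∈ (extChartAt I p).target)
    (u : E) :
    (mfderiv 𝓘(ℝ, E) I (extChartAt I p).symm y : E →L[ℝ] E) (endoInChart I φ p y u) =
      (φ ((extChartAt I p).symm y) : E →L[ℝ] E)
        ((mfderiv 𝓘(ℝ, E) I (extChartAt I p).symm y : E →L[ℝ] E) u) :=
  congrArg (fun L : E →L[ℝ] E => L ((φ ((extChartAt I p).symm y) : E →L[ℝ] E)
        ((mfderiv 𝓘(ℝ, E) I (extChartAt I p).symm y : E →L[ℝ] E) u)))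
    (mfderiv_extChartAt_symm_comp I hy)

lemma contDiffAt_metricInChart (p : M) :
    ContDiffAt ℝ ∞ (metricInChart I g.inner p) (extChartAt I p p) :=
  (contMDiffAt_metric_iff I g.inner p).mp g.contMDiff.contMDiffAt

variable [FiniteDimensional ℝ E]

/-- The connection map is independent of the chart. -/
lemma connectionMap_transition {p : M} {y : E} (hy : y ∈ (extChartAt I p).target)
    (hd : DifferentiableAt ℝ (metricInChart I g.inner p) y) (u a α : E) :
    (fderiv ℝ (fun x => extChartAt I ((extChartAt I p).symm y) ((extChartAt I p).symm x)) y α +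
      fderiv ℝ (fderiv ℝ (fun x => extChartAt I ((extChartAt I p).symm y)
        ((extChartAt I p).symm x))) y a u) +
      christoffel (metricInChart I g.inner ((extChartAt I p).symm y))
        (extChartAt I ((extChartAt I p).symm y) ((extChartAt I p).symm y))
        (fderiv ℝ (fun x => extChartAt I ((extChartAt I p).symm y) ((extChartAt I p).symm x)) y a)
        (fderiv ℝ (fun x => extChartAt I ((extChartAt I p).symm y) ((extChartAt I p).symm x)) y u) =
    fderiv ℝ (fun x => extChartAt I ((extChartAt I p).symm y) ((extChartAt I p).symm x)) y
      (connectionMapLocal (metricInChart I g.inner p) (y, u) (a, α)) := by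
  set q := (extChartAt I p).symm y with hq
  have hqs : (extChartAt I p).symm y ∈ (extChartAt I q).source := mem_extChartAt_source q
  set κ : E → E := fun x => extChartAt I q ((extChartAt I p).symm x) with hκ
  have hκy : κ y = extChartAt I q q := rfl
  have hcont : ContinuousAt (extChartAt I p).symm y := continuousAt_extChartAt_symm'' hy
  have hsurj : Function.Surjective (fderiv ℝ κ y) := by
    rw [hκ, ← mfderiv_extChartAt_symm_eq_fderiv I hy]
    intro b
    exact ⟨_, congrArg (fun L : E →L[ℝ] E => L b) (mfderiv_extChartAt_symm_comp I hy)⟩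
  have hpull : ∀ᶠ z in 𝓝 y, ∀ b c, metricInChart I g.inner p z b c =
      metricInChart I g.inner q (κ z) (fderiv ℝ κ z b) (fderiv ℝ κ z c) := by
    filter_upwards [extChartAt_target_mem_nhds' hy,
      hcont.preimage_mem_nhds ((isOpen_extChartAt_source q).mem_nhds hqs)] with z hz1 hz2 b c
    exact metricInChart_eq_comp I g.inner hz1 hz2 b c
  -- The inhomogeneous term of this transformation law is the second-derivative term in the tangent
  -- map of the transition.
  have key := fderiv_apply_christoffel (κ := κ)
    (isInvertible_of_pos (metricInChart_pos I g hy))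
    (isInvertible_of_pos (metricInChart_pos I g (hκy ▸ mem_extChartAt_target q)))
    ((contDiffAt_metricInChart I g q).differentiableAt (by simp))
    (Eventually.of_forall fun z => metricInChart_symm I g q z)
    (contDiffAt_transition I hy hqs) hsurj hpull hd a u
  rw [connectionMapLocal_apply, map_add, key, add_assoc]

/-- The deformed Sasaki metric in a chart of the tangent bundle. -/
lemma metricInChart_bergerSasaki (δ : ℝ) (v : TangentBundle I M) {z : E × E}
    (hz : z.1 ∈ (extChartAt I v.proj).target)
    (hd : DifferentiableAt ℝ (metricInChart I g.inner v.proj) z.1) :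
    metricInChart I.tangent (bergerSasaki I g φ δ) v z =
      bergerSasakiLocal (metricInChart I g.inner v.proj) (endoInChart I φ v.proj) δ z := by
  let bs : TangentBundle I M → E × E →L[ℝ] E × E →L[ℝ] ℝ := bergerSasaki I g φ δ
  -- The point w whose preferred chart is the target stays a variable, so that the point with
  -- coordinates z can later be rewritten as an explicit pair.
  let T : TangentBundle I M → E × E →L[ℝ] E × E := fun w =>
    fderiv ℝ (fun z => extChartAt I.tangent w ((extChartAt I.tangent v).symm z)) z
  have h1 : metricInChart I.tangent (bergerSasaki I g φ δ) v z =
      (bs ((extChartAt I.tangent v).symm z)).bilinearComp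
        (T ((extChartAt I.tangent v).symm z)) (T ((extChartAt I.tangent v).symm z)) := by
    have h2 := mfderiv_extChartAt_symm_eq_fderiv I.tangent
      ((mem_extChartAt_tangent_target_iff I v z).mpr hz)
    simp only [T]
    rw [← h2]
    rfl
  rw [h1, extChartAt_tangent_symm_apply I v hz]
  obtain ⟨y, u⟩ := z
  simp only at hz hd
  set q := (extChartAt I v.proj).symm y with hq
  set D : E →L[ℝ] E := mfderiv 𝓘(ℝ, E) I (extChartAt I v.proj).symm y with hD
  have hDκ : D = fderiv ℝ (fun x => extChartAt I q ((extChartAt I v.proj).symm x)) y :=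
    mfderiv_extChartAt_symm_eq_fderiv I hz
  set w : TangentBundle I M := ⟨q, D u⟩ with hw
  have hT : ∀ A, T w A = (D A.1, D A.2 +
      fderiv ℝ (fderiv ℝ (fun x => extChartAt I q ((extChartAt I v.proj).symm x))) y A.1 u) := by
    intro A
    rw [hDκ]
    exact fderiv_tangent_transition I v w (z := (y, u)) hz (mem_extChartAt_source q) A
  have hK : ∀ A, (connectionMap I g.inner w : E × E →L[ℝ] E) (T w A) =
      D (connectionMapLocal (metricInChart I g.inner v.proj) (y, u) A) := by
    intro A
    have := connectionMap_transition I g hz hd u A.1 A.2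
    rw [← hq, ← hDκ] at this
    rw [hT]
    exact this
  have hφ := mfderiv_extChartAt_symm_endoInChart I φ hz u
  refine ContinuousLinearMap.ext fun A => ContinuousLinearMap.ext fun B => ?_
  have h3 : ∀ b c, metricInChart I g.inner v.proj y b c =
    (g.inner q : E →L[ℝ] E →L[ℝ] ℝ) (D b) (D c) := fun b c => rfl
  rw [bergerSasakiLocal_apply]
  refine (bergerSasaki_apply I g φ δ w (T w A) (T w B)).trans ?_
  simp only [fiberMetric, h3]
  let γ : E →L[ℝ] E →L[ℝ] ℝ := g.inner q
  let K : E × E →L[ℝ] E := connectionMap I g.inner w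
  have hφ' : D (endoInChart I φ v.proj y u) = (φ q : E →L[ℝ] E) (D u) := hφ
  rw [hφ']
  change γ (T w A).1 (T w B).1 + γ (K (T w A)) (K (T w B)) +
    δ ^ 2 * (γ ((φ q : E →L[ℝ] E) (D u)) (K (T w A)) * γ ((φ q : E →L[ℝ] E) (D u)) (K (T w B))) = _
  have hA : K (T w A) = _ := hK A
  have hB : K (T w B) = _ := hK B
  rw [hA, hB, hT A, hT B, add_assoc]
  rfl

end MetricInChart

lemma christoffel_congr {V : Type*} [NormedAddCommGroup V] [NormedSpace ℝ V]
    {G G' : V → V →L[ℝ] V →L[ℝ] ℝ} {y : V} (h : G =ᶠ[𝓝 y] G') :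
    christoffel G y = christoffel G' y := by
  unfold christoffel
  rw [h.fderiv_eq, h.eq_of_nhds]

/-! ### The projection of the tangent bundle: submersion, second fundamental form, tension. -/

section Projection

variable {E : Type*} [NormedAddCommGroup E] [NormedSpace ℝ E]
  {H : Type*} [TopologicalSpace H] (I : ModelWithCorners ℝ E H)
  {M : Type*} [TopologicalSpace M] [ChartedSpace H M] [IsManifold I ∞ M]

lemma extChartAt_tangent_self (v : TangentBundle I M) :
    extChartAt I.tangent v v = ((extChartAt I v.proj v.proj, v.2) : E × E) := by
  rw [extChartAt_tangent_apply I v v (mem_extChartAt_source _)]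
  refine Prod.ext rfl ?_
  exact congrArg (fun L : E →L[ℝ] E => L v.2) mfderiv_extChartAt_self

variable (g : Bundle.ContMDiffRiemannianMetric I ∞ E (TangentSpace I : M → Type _))
  (φ : ∀ q : M, TangentSpace I q →L[ℝ] TangentSpace I q) (δ : ℝ)

/-- Testing orthogonality on the vertical lift of K A gives g(K A, K A) plus a nonnegative term
equal to zero. -/
lemma connectionMap_eq_zero_of_orthogonal (v : TangentBundle I M) (A : TangentSpace I.tangent v)
    (hA : ∀ C, mfderiv I.tangent I (Bundle.TotalSpace.proj : TangentBundle I M → M) v C = 0 →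
      bergerSasaki I g φ δ v A C = 0) :
    connectionMap I g.inner v A = 0 := by
  by_contra hne
  set k := connectionMap I g.inner v A with hk
  have h1 := hA (verticalLift I v k) (mfderiv_proj_apply I v _)
  rw [bergerSasaki_apply, connectionMap_verticalLift, ← hk] at h1
  have h2 : g.inner v.proj (A : E × E).1 (verticalLift I v k : E × E).1 = 0 := map_zero _
  rw [h2] at h1
  have h3 := g.pos v.proj k hne
  have h4 := mul_nonneg (sq_nonneg δ) (mul_self_nonneg (g.inner v.proj (φ v.proj v.2) k))
  linarith

lemma isRiemannianSubmersion_proj :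
    IsRiemannianSubmersion I.tangent I (bergerSasaki I g φ δ) g.inner
      (Bundle.TotalSpace.proj : TangentBundle I M → M) where
  contMDiff := Bundle.contMDiff_proj (TangentSpace I : M → Type _)
  surjective p := ⟨⟨p, 0⟩, rfl⟩
  surjective_mfderiv v X := ⟨((X, 0) : E × E), mfderiv_proj_apply I v _⟩
  isometric v A B hA hB := by
    have h0 : ∀ Z : TangentSpace I v.proj, g.inner v.proj Z (0 : TangentSpace I v.proj) = 0 :=
      fun Z => map_zero _
    rw [mfderiv_proj_apply, mfderiv_proj_apply, bergerSasaki_apply,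
      connectionMap_eq_zero_of_orthogonal I g φ δ v A hA,
      connectionMap_eq_zero_of_orthogonal I g φ δ v B hB, h0, h0]
    ring

variable [I.Boundaryless]

lemma writtenInExtChartAt_proj_eventuallyEq (v : TangentBundle I M) :
    writtenInExtChartAt I.tangent I v (Bundle.TotalSpace.proj : TangentBundle I M → M)
      =ᶠ[𝓝 ((extChartAt I v.proj v.proj, v.2) : E × E)] (Prod.fst : E × E → E) := by
  have h1 : ∀ᶠ y in 𝓝 (extChartAt I v.proj v.proj), y ∈ (extChartAt I v.proj).target :=
    extChartAt_target_mem_nhds v.proj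
  filter_upwards [continuousAt_fst.eventually h1] with z hz
  change extChartAt I v.proj ((extChartAt I.tangent v).symm z).proj = z.1
  rw [extChartAt_tangent_symm_apply I v hz]
  exact (extChartAt I v.proj).right_inv hz

variable {φ} in
lemma isParallelAt (hφ : IsAntiParaKahler I g φ) (p : M) :
    IsParallelAt (metricInChart I g.inner p) (endoInChart I φ p) (extChartAt I p p) where
  pos := metricInChart_pos I g (mem_extChartAt_target p)
  symm := Eventually.of_forall fun y => metricInChart_symm I g p y
  contDiffAt_metric := contDiffAt_metricInChart I g p
  contDiffAt_endo := contDiffAt_endoInChart I hφ.contMDiff.contMDiffAt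
  parallel a b := by
    rw [endoInChart_self]
    exact hφ.parallel p a b

variable [FiniteDimensional ℝ E]

lemma metricInChart_bergerSasaki_eventuallyEq (v : TangentBundle I M) :
    metricInChart I.tangent (bergerSasaki I g φ δ) v
      =ᶠ[𝓝 ((extChartAt I v.proj v.proj, v.2) : E × E)]
      bergerSasakiLocal (metricInChart I g.inner v.proj) (endoInChart I φ v.proj) δ := by
  have h1 : ∀ᶠ y in 𝓝 (extChartAt I v.proj v.proj), y ∈ (extChartAt I v.proj).target :=
    extChartAt_target_mem_nhds v.proj
  have h2 : ∀ᶠ y in 𝓝 (extChartAt I v.proj v.proj),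
      DifferentiableAt ℝ (metricInChart I g.inner v.proj) y := by
    -- Smoothness is known at the centre of the chart only; being C¹, unlike the order ∞, is an open
    -- condition, and it gives differentiability at nearby points.
    have h3 : ContDiffAt ℝ 1 (metricInChart I g.inner v.proj) (extChartAt I v.proj v.proj) :=
      (contDiffAt_metricInChart I g v.proj).of_le ENat.LEInfty.out
    exact (h3.eventually (by simp)).mono fun y hy => hy.differentiableAt one_ne_zero
  filter_upwards [continuousAt_fst.eventually (h1.and h2)] with z hz
  exact metricInChart_bergerSasaki I g φ δ v hz.1 hz.2

/-- The chart formula at the centre, where the chart derivative is the identity. Symmetry,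
positivity and the inverse metric in the trace are read off from it. -/
lemma bergerSasaki_eq_local (v : TangentBundle I M) :
    (bergerSasaki I g φ δ v : E × E →L[ℝ] E × E →L[ℝ] ℝ) =
      bergerSasakiLocal (metricInChart I g.inner v.proj) (endoInChart I φ v.proj) δ
        (extChartAt I v.proj v.proj, v.2) := by
  rw [← (metricInChart_bergerSasaki_eventuallyEq I g φ δ v).eq_of_nhds,
    ← extChartAt_tangent_self]
  exact (metricInChart_self I.tangent _ v).symm

/-- In induced charts the projection is linear, so its Hessian vanishes. The Christoffel symbols
depend only on the germ of the metric, hence the local formula may replace it. -/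
lemma secondFundamentalForm_proj (v : TangentBundle I M) (A B : E × E) :
    (secondFundamentalForm I.tangent I (bergerSasaki I g φ δ) g.inner
      (Bundle.TotalSpace.proj : TangentBundle I M → M) v A B : E) =
    secondFundamentalFormLocal (metricInChart I g.inner v.proj) (endoInChart I φ v.proj) δ
        (extChartAt I v.proj v.proj, v.2) A B := by
  have hF := writtenInExtChartAt_proj_eventuallyEq I v
  have h1 : fderiv ℝ (writtenInExtChartAt I.tangent I v
      (Bundle.TotalSpace.proj : TangentBundle I M → M)) (extChartAt I v.proj v.proj, v.2) =
        ContinuousLinearMap.fst ℝ E E := by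
    rw [hF.fderiv_eq, fderiv_fst]
  have h2 : fderiv ℝ (fderiv ℝ (writtenInExtChartAt I.tangent I v
      (Bundle.TotalSpace.proj : TangentBundle I M → M))) (extChartAt I v.proj v.proj, v.2) = 0 := by
    rw [hF.fderiv.fderiv_eq]
    have : fderiv ℝ (Prod.fst : E × E → E) = fun _ => ContinuousLinearMap.fst ℝ E E :=
      funext fun z => fderiv_fst
    rw [this]
    exact fderiv_const_apply _
  have h3 := christoffel_congr (metricInChart_bergerSasaki_eventuallyEq I g φ δ v)
  change fderiv ℝ (fderiv ℝ (writtenInExtChartAt I.tangent I v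
      (Bundle.TotalSpace.proj : TangentBundle I M → M))) (extChartAt I.tangent v v) A B -
    fderiv ℝ (writtenInExtChartAt I.tangent I v
      (Bundle.TotalSpace.proj : TangentBundle I M → M)) (extChartAt I.tangent v v)
      (christoffel (V := E × E) (metricInChart I.tangent (bergerSasaki I g φ δ) v)
        (extChartAt I.tangent v v) A B) +
    christoffel (metricInChart I g.inner v.proj) (extChartAt I v.proj v.proj)
      (fderiv ℝ (writtenInExtChartAt I.tangent I v
      (Bundle.TotalSpace.proj : TangentBundle I M → M)) (extChartAt I.tangent v v) A)
      (fderiv ℝ (writtenInExtChartAt I.tangent I v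
      (Bundle.TotalSpace.proj : TangentBundle I M → M)) (extChartAt I.tangent v v) B) = _
  rw [extChartAt_tangent_self, h1, h2, h3]
  simp [secondFundamentalFormLocal]

lemma bergerSasaki_symm (v : TangentBundle I M) (A B : TangentSpace I.tangent v) :
    bergerSasaki I g φ δ v A B = bergerSasaki I g φ δ v B A := by
  rw [bergerSasaki_eq_local]
  exact bergerSasakiLocal_symm _ δ (metricInChart_symm I g v.proj _) A B

lemma bergerSasaki_pos (v : TangentBundle I M) (A : TangentSpace I.tangent v) (hA : A ≠ 0) :
    0 < bergerSasaki I g φ δ v A A := by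
  rw [bergerSasaki_eq_local]
  exact bergerSasakiLocal_pos _ δ (metricInChart_pos I g (mem_extChartAt_target v.proj)) A hA

variable {φ} in
/-- The Berger type deformed Sasaki metric as a smooth Riemannian metric. -/
def bergerSasakiMetric (hφ : IsAntiParaKahler I g φ) :
    Bundle.ContMDiffRiemannianMetric I.tangent ∞ (E × E)
      (TangentSpace I.tangent : TangentBundle I M → Type _) where
  inner := bergerSasaki I g φ δ
  symm := bergerSasaki_symm I g φ δ
  pos := bergerSasaki_pos I g φ δ
  isVonNBounded v :=
    isVonNBounded_of_pos (V := E × E) (B := bergerSasaki I g φ δ v) (bergerSasaki_pos I g φ δ v)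
  contMDiff v := by
    rw [contMDiffAt_metric_iff, extChartAt_tangent_self]
    exact ((isParallelAt I g hφ v.proj).contDiffAt_bergerSasakiLocal δ v.2).congr_of_eventuallyEq
      (metricInChart_bergerSasaki_eventuallyEq I g φ δ v)

variable {φ} in
-- All vectors in the fibre over p share the chart at p, so the local equivalence at p, with u
-- ranging over the whole fibre, applies point by point.
lemma isTotallyGeodesic_proj_iff (hφ : IsAntiParaKahler I g φ) :
    IsTotallyGeodesic I.tangent I (bergerSasaki I g φ δ) g.inner
      (Bundle.TotalSpace.proj : TangentBundle I M → M) ↔ IsLocallyFlat I g.inner := by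
  constructor
  · rintro ⟨-, h⟩ p
    refine ((isParallelAt I g hφ p).secondFundamentalFormLocal_eq_zero_iff (δ := δ)).mp ?_
    intro u A B
    exact (secondFundamentalForm_proj I g φ δ (⟨p, u⟩ : TangentBundle I M) A B).symm.trans
      (h ⟨p, u⟩ A B)
  · intro h
    refine ⟨Bundle.contMDiff_proj (TangentSpace I : M → Type _), fun v A B => ?_⟩
    exact (secondFundamentalForm_proj I g φ δ v A B).trans
      (((isParallelAt I g hφ v.proj).secondFundamentalFormLocal_eq_zero_iff (δ := δ)).mpr
        (h v.proj) v.2 A B)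

variable {φ} in
lemma isHarmonic_proj (hφ : IsAntiParaKahler I g φ) :
    IsHarmonic I.tangent I (bergerSasaki I g φ δ) g.inner
      (Bundle.TotalSpace.proj : TangentBundle I M → M) := by
  refine ⟨Bundle.contMDiff_proj (TangentSpace I : M → Type _), fun v => ?_⟩
  have h := (isParallelAt I g hφ v.proj).sum_secondFundamentalFormLocal_eq_zero (δ := δ) v.2
    (Module.finBasis ℝ (E × E))
  rw [← bergerSasaki_eq_local] at h
  simp only [← secondFundamentalForm_proj] at h
  exact h

end Projection

end BergerSasaki

end

theorem mainTheorem1 {E : Type*} [NormedAddCommGroup E] [NormedSpace ℝ E] [FiniteDimensional ℝ E]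
    {M : Type*} [TopologicalSpace M] [ChartedSpace E M] [IsManifold 𝓘(ℝ, E) ∞ M]
    (g : Bundle.ContMDiffRiemannianMetric 𝓘(ℝ, E) ∞ E (TangentSpace 𝓘(ℝ, E) : M → Type _))
    (φ : ∀ q : M, TangentSpace 𝓘(ℝ, E) q →L[ℝ] TangentSpace 𝓘(ℝ, E) q)
    (hφ : BergerSasaki.IsAntiParaKahler 𝓘(ℝ, E) g φ) (δ : ℝ) :
    ∃ gBS : Bundle.ContMDiffRiemannianMetric (𝓘(ℝ, E).tangent) ∞ (E × E)
        (TangentSpace 𝓘(ℝ, E).tangent : TangentBundle 𝓘(ℝ, E) M → Type _),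
      gBS.inner = BergerSasaki.bergerSasaki 𝓘(ℝ, E) g φ δ ∧
      BergerSasaki.IsRiemannianSubmersion 𝓘(ℝ, E).tangent 𝓘(ℝ, E) gBS.inner g.inner
        (Bundle.TotalSpace.proj : TangentBundle 𝓘(ℝ, E) M → M) ∧
      (BergerSasaki.IsTotallyGeodesic 𝓘(ℝ, E).tangent 𝓘(ℝ, E) gBS.inner g.inner
          (Bundle.TotalSpace.proj : TangentBundle 𝓘(ℝ, E) M → M) ↔
        BergerSasaki.IsLocallyFlat 𝓘(ℝ, E) g.inner) ∧
      BergerSasaki.IsHarmonic 𝓘(ℝ, E).tangent 𝓘(ℝ, E) gBS.inner g.inner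
        (Bundle.TotalSpace.proj : TangentBundle 𝓘(ℝ, E) M → M) :=
  ⟨BergerSasaki.bergerSasakiMetric 𝓘(ℝ, E) g δ hφ, rfl,
    BergerSasaki.isRiemannianSubmersion_proj 𝓘(ℝ, E) g φ δ,
    BergerSasaki.isTotallyGeodesic_proj_iff 𝓘(ℝ, E) g δ hφ,
    BergerSasaki.isHarmonic_proj 𝓘(ℝ, E) g δ hφ⟩
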